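/- Let $\bar\theta\in(0,\pi/2)$, $\alpha>1$, and let $K=\{(x_1,x_2)\in\mathbb{R}^2 : x_1\le 0,\ x_1\cos\bar\theta+x_2\sin\bar\theta\le 0\}$, with $P_K$ the (nearest point) projection onto $K$. For $u,v\in\mathbb{R}^2$ put $$G(u,v)=\frac{\bigl(v\cdot(u-P_Ku)\bigr)(u-P_Ku)}{|u-P_Ku|^2}\ \text{ if } u\notin K,\qquad G(u,v)=0\ \text{ if } u\in K.$$ Fix $x_2(0)<0$, $\dot x_1(0)>0$, $\dot x_2(0)>0$, and set $u(0)=(0,x_2(0))$, $\dot u(0)=(\dot x_1(0),\dot x_2(0))$, $t_0=-x_2(0)/\dot x_2(0)$. For $k>0$ let $u_k:[0,\infty)\to\mathbb{R}^2$ be a solution of the penalized problem $$\ddot u_k+2\alpha\sqrt{k}\,G(u_k,\dot u_k)+k\,(u_k-P_Ku_k)=0,\qquad u_k(0)=u(0),\quad \dot u_k(0)=\dot u(0),$$ that is, $u_k$ is $C^1$ on $[0,\infty)$, $\dot u_k$ is locally absolutely continuous and the equation holds for almost every $t$. Let $\Pi_1$ and $\Pi_2$ be the orthogonal projections on the lines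 $\{x_1=0\}$ and $\{x_1\cos\bar\theta+x_2\sin\bar\theta=0\}$. Then such a $u_k$ exists for all sufficiently large $k$; for all sufficiently large $k$ one has $\Pi_1\dot u_k(t_0)=\Pi_1\dot u(0)$ (this common value is denoted $\Pi_1\dot u(t_0)$); and, as $k\to\infty$, $u_k$ converges uniformly on compact subsets of $[0,\infty)$ to $$u_\infty(t)=\begin{cases}u(0)+t\,\Pi_1\dot u(0)&\text{if } 0\le t\le t_0,\\ (t-t_0)\,\Pi_2\Pi_1\dot u(t_0)&\text{if } t\ge t_0.\end{cases}$$ -/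

import Mathlib

open Filter Topology MeasureTheory

noncomputable section

namespace CornerImpact

/-- The Euclidean plane. The coordinates written `x₁, x₂` below are `x 0, x 1`. -/
abbrev Plane : Type := EuclideanSpace ℝ (Fin 2)

/-- The angular domain `K`. -/
def cone (θ : ℝ) : Set Plane :=
  {x | x 0 ≤ 0 ∧ x 0 * Real.cos θ + x 1 * Real.sin θ ≤ 0}

/-- Every point of the plane has exactly one nearest point in `K`. -/
theorem existsUnique_nearest (θ : ℝ) (x : Plane) :
    ∃! y : Plane, y ∈ cone θ ∧ ∀ z ∈ cone θ, dist x y ≤ dist x z := by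
  have hcl : IsClosed (cone θ) := by
    have h0 : Continuous fun x : Plane => x 0 := by fun_prop
    have h1 : Continuous fun x : Plane => x 0 * Real.cos θ + x 1 * Real.sin θ := by fun_prop
    exact (isClosed_le h0 continuous_const).inter (isClosed_le h1 continuous_const)
  have hne : (cone θ).Nonempty := ⟨0, by simp [cone]⟩
  obtain ⟨y, hy, hxy⟩ := hcl.exists_infDist_eq_dist hne x
  have hmin : ∀ z ∈ cone θ, dist x y ≤ dist x z := fun z hz => by
    rw [← hxy]; exact Metric.infDist_le_dist_of_mem hz
  refine ⟨y, ⟨hy, hmin⟩, ?_⟩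
  rintro z ⟨hz, hzmin⟩
  have hd : dist x z = dist x y := le_antisymm (hzmin y hy) (hmin z hz)
  have hm : (1 / 2 : ℝ) • (y + z) ∈ cone θ := by
    obtain ⟨h1, h2⟩ := hy
    obtain ⟨h3, h4⟩ := hz
    constructor
    · simp only [PiLp.smul_apply, PiLp.add_apply, smul_eq_mul]; linarith
    · simp only [PiLp.smul_apply, PiLp.add_apply, smul_eq_mul]; linarith
  have h := hmin _ hm
  rw [dist_eq_norm, dist_eq_norm] at hd h
  have hpar := parallelogram_law_with_norm ℝ (x - y) (x - z)
  have e1 : (x - y) + (x - z) = (2 : ℝ) • (x - (1 / 2 : ℝ) • (y + z)) := by module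
  have e2 : (x - y) - (x - z) = z - y := by abel
  rw [e1, e2, norm_smul, hd] at hpar
  norm_num at hpar
  have h0 := norm_nonneg (x - y)
  have : ‖z - y‖ = 0 := by
    norm_num at h
    nlinarith [norm_nonneg (z - y), mul_self_le_mul_self h0 h]
  exact sub_eq_zero.mp (norm_eq_zero.mp this)

/-- The projection `P_K` onto `K`: the nearest point of `K`. -/
def projCone (θ : ℝ) (x : Plane) : Plane := (existsUnique_nearest θ x).choose

/-- The damping direction: `G(x, v) = (v · n) n / |n|²` with `n = x - P_K x` outside `K`,
and `0` on `K`. -/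
def damping (θ : ℝ) (x v : Plane) : Plane :=
  open Classical in
  if x ∈ cone θ then 0
  else (inner ℝ v (x - projCone θ x) / ‖x - projCone θ x‖ ^ 2) • (x - projCone θ x)

/-- `2 α √k G(x, v) + k (x - P_K x)`, so that the penalized equation reads
`ü + penaltyForce θ α k u u̇ = 0`. -/
def penaltyForce (θ α k : ℝ) (x v : Plane) : Plane :=
  (2 * α * √k) • damping θ x v + k • (x - projCone θ x)

/-- `u` is a solution on `[0, ∞)` of the penalized equation with stiffness `k`, starting at `u₀`
with velocity `v₀`. Since `G` is discontinuous across the boundary of `K`, where the motion starts,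
this is meant in the sense of Carathéodory: `u` is continuously differentiable on `[0, ∞)`
(one-sidedly at `0`), and its velocity `v` is an indefinite integral of `-penaltyForce` along `u`,
that is, `v` is locally absolutely continuous and satisfies the equation almost everywhere. -/
def IsPenaltySolution (θ α k : ℝ) (u₀ v₀ : Plane) (u : ℝ → Plane) : Prop :=
  u 0 = u₀ ∧
  ∃ v : ℝ → Plane,
    ContinuousOn v (Set.Ici 0) ∧
    (∀ t, 0 ≤ t → HasDerivWithinAt u (v t) (Set.Ici 0) t) ∧
    ∀ t, 0 ≤ t →
      IntervalIntegrable (fun s => penaltyForce θ α k (u s) (v s)) volume 0 t ∧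
      v t = v₀ - ∫ s in (0 : ℝ)..t, penaltyForce θ α k (u s) (v s)

/-- The line `{x₁ = 0}` carrying the first side of `K`. -/
def line₁ : Submodule ℝ Plane where
  carrier := {x | x 0 = 0}
  add_mem' := fun {a b} (ha : a 0 = 0) (hb : b 0 = 0) => by
    change (a + b) 0 = 0
    simp [ha, hb]
  zero_mem' := by simp
  smul_mem' := fun c a (ha : a 0 = 0) => by
    change (c • a) 0 = 0
    simp [ha]

/-- The line `{x₁ cos θ + x₂ sin θ = 0}` carrying the second side of `K`. -/
def line₂ (θ : ℝ) : Submodule ℝ Plane where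
  carrier := {x | x 0 * Real.cos θ + x 1 * Real.sin θ = 0}
  add_mem' := fun {a b} (ha : a 0 * Real.cos θ + a 1 * Real.sin θ = 0)
      (hb : b 0 * Real.cos θ + b 1 * Real.sin θ = 0) => by
    change (a + b) 0 * Real.cos θ + (a + b) 1 * Real.sin θ = 0
    simp only [PiLp.add_apply]
    linear_combination ha + hb
  zero_mem' := by simp
  smul_mem' := fun c a (ha : a 0 * Real.cos θ + a 1 * Real.sin θ = 0) => by
    change (c • a) 0 * Real.cos θ + (c • a) 1 * Real.sin θ = 0
    simp only [PiLp.smul_apply, smul_eq_mul]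
    linear_combination c * ha

/-- The orthogonal projection `Π₁` onto the first line. -/
def proj₁ : Plane →L[ℝ] Plane := line₁.starProjection

/-- The orthogonal projection `Π₂` onto the second line. -/
def proj₂ (θ : ℝ) : Plane →L[ℝ] Plane := (line₂ θ).starProjection

/-- The motion that starts at `u₀` with velocity `Π₁ v₀` and, from the time `t₀` on, leaves the
corner with velocity `Π₂ Π₁ v₀`. -/
def limitMotion (θ t₀ : ℝ) (u₀ v₀ : Plane) (t : ℝ) : Plane :=
  if t ≤ t₀ then u₀ + t • proj₁ v₀ else (t - t₀) • proj₂ θ (proj₁ v₀)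

end CornerImpact

end

namespace CornerImpact

/-! Facing one side of the cone, the penalty force is normal to that side and linear in the normal
position and velocity (`IsSide.penaltyForce_eq`). The tangential motion is then free, and the normal
one is overdamped because `α > 1`, with rates `√k (α ± √(α² - 1))`. A point launched outward from
the side stays outside, at distance `O(1/√k)`, until it passes the apex (`IsMotionOn.eq_on_side`).
On the first side this holds exactly up to `t₀`, which gives the claim on `Π₁`; at that time the
distance `ε` to the side is exponentially small in `√k` (`tendsto_sqrt_mul_gap`).

The point then faces the apex, where the force is nonlinear. But the crossing lasts a time `O(ε)`
under a force `O(√k + kε)`, so it changes the velocity by `O(√k ε + k ε²)`, which tends to `0`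
(`IsMotionOn.crossing`, `tendsto_crossingError`). The normal velocity at `t₀` has decayed as well,
so the point comes to face the second side with a velocity close to `Π₁ u̇(0)`. There the normal
part is damped again and only the tangential part `Π₂ Π₁ u̇(0)` survives in the limit. These
estimates hold for every solution, so uniqueness is never needed.

For existence, both slides are explicit, the crossing is solved by Picard-Lindelöf in a tube away
from the cone, where the damping is Lipschitz, and the pieces are glued in integral form, which
tolerates the jumps of the force. -/

/-! ### The projection on the cone and its residual -/

theorem projCone_mem (θ : ℝ) (x : Plane) : projCone θ x ∈ cone θ :=
  (existsUnique_nearest θ x).choose_spec.1.1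

theorem dist_projCone_le (θ : ℝ) (x : Plane) {z : Plane} (hz : z ∈ cone θ) :
    dist x (projCone θ x) ≤ dist x z :=
  (existsUnique_nearest θ x).choose_spec.1.2 z hz

theorem projCone_eq {θ : ℝ} {x y : Plane} (hy : y ∈ cone θ)
    (h : ∀ z ∈ cone θ, dist x y ≤ dist x z) : projCone θ x = y :=
  ((existsUnique_nearest θ x).choose_spec.2 y ⟨hy, h⟩).symm

theorem zero_mem_cone (θ : ℝ) : (0 : Plane) ∈ cone θ := by simp [cone]

theorem convex_cone (θ : ℝ) : Convex ℝ (cone θ) := by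
  rintro x ⟨hx, hx'⟩ y ⟨hy, hy'⟩ a b ha hb -
  constructor
  · simp only [PiLp.smul_apply, PiLp.add_apply, smul_eq_mul]; nlinarith
  · simp only [PiLp.smul_apply, PiLp.add_apply, smul_eq_mul]
    nlinarith [mul_nonneg ha (neg_nonneg.2 hx'), mul_nonneg hb (neg_nonneg.2 hy')]

theorem norm_sub_projCone_le (θ : ℝ) (x : Plane) : ‖x - projCone θ x‖ ≤ ‖x‖ := by
  simpa [dist_eq_norm] using dist_projCone_le θ x (zero_mem_cone θ)

theorem norm_sub_projCone_eq_iInf (θ : ℝ) (x : Plane) :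
    ‖x - projCone θ x‖ = ⨅ w : cone θ, ‖x - w‖ := by
  have : Nonempty (cone θ) := ⟨⟨0, zero_mem_cone θ⟩⟩
  refine le_antisymm (le_ciInf fun w => ?_) ?_
  · simpa [dist_eq_norm] using dist_projCone_le θ x w.2
  · exact ciInf_le ⟨0, by rintro _ ⟨w, rfl⟩; exact norm_nonneg _⟩
      (⟨projCone θ x, projCone_mem θ x⟩ : cone θ)

theorem inner_sub_projCone_le (θ : ℝ) (x : Plane) {z : Plane} (hz : z ∈ cone θ) :
    inner ℝ (x - projCone θ x) (z - projCone θ x) ≤ 0 :=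
  (norm_eq_iInf_iff_real_inner_le_zero (convex_cone θ) (projCone_mem θ x)).1
    (norm_sub_projCone_eq_iInf θ x) z hz

/-- The residual `x - P_K x` is a nonexpansive function of `x`. -/
theorem norm_residual_sub_le (θ : ℝ) (x y : Plane) :
    ‖(x - projCone θ x) - (y - projCone θ y)‖ ≤ ‖x - y‖ := by
  have h1 := inner_sub_projCone_le θ x (projCone_mem θ y)
  have h2 := inner_sub_projCone_le θ y (projCone_mem θ x)
  set P := projCone θ x
  set Q := projCone θ y
  -- Both inner products in this expansion are nonpositive by the obtuse angle criterion, applied at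
  -- `x` and at `y`.
  have h : ‖x - y‖ ^ 2 = ‖(x - P) - (y - Q)‖ ^ 2 + ‖P - Q‖ ^ 2
      - 2 * inner ℝ (x - P) (Q - P) - 2 * inner ℝ (y - Q) (P - Q) := by
    have e : x - y = ((x - P) - (y - Q)) + (P - Q) := by abel
    have e' : Q - P = -(P - Q) := by abel
    rw [e, norm_add_sq_real, e', inner_neg_right, inner_sub_left (x - P)]
    ring
  refine abs_le_of_sq_le_sq' ?_ (norm_nonneg _) |>.2
  nlinarith [sq_nonneg ‖P - Q‖]

/-- On the cone the residual vanishes and both sides are `0` (division by zero included), so the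
case distinction can be dropped. -/
theorem damping_eq (θ : ℝ) (x v : Plane) :
    damping θ x v =
      (inner ℝ v (x - projCone θ x) / ‖x - projCone θ x‖ ^ 2) • (x - projCone θ x) := by
  unfold damping
  split_ifs with hx
  · have : projCone θ x = x := projCone_eq hx fun z _ => by simp
    simp [this]
  · rfl

/-! ### Growth and Lipschitz bounds for the penalty force -/

/-- The component of `v` along `n` is a Lipschitz function of `n` and `v`, for bounded `v` and `n`
away from `0`. -/
theorem norm_component_sub_le {c M : ℝ} (hc : 0 < c) {n n' v v' : Plane} (hn : c ≤ ‖n‖)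
    (hn' : c ≤ ‖n'‖) (hv' : ‖v'‖ ≤ M) :
    ‖(inner ℝ v n / ‖n‖ ^ 2) • n - (inner ℝ v' n' / ‖n'‖ ^ 2) • n'‖
      ≤ ‖v - v'‖ + 4 * M / c * ‖n - n'‖ := by
  have hn0 : 0 < ‖n‖ := hc.trans_le hn
  have hn0' : 0 < ‖n'‖ := hc.trans_le hn'
  obtain ⟨e, he⟩ : ∃ e, e = ‖n‖⁻¹ • n := ⟨_, rfl⟩
  obtain ⟨e', he'⟩ : ∃ e, e = ‖n'‖⁻¹ • n' := ⟨_, rfl⟩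
  have h1 : (inner ℝ v n / ‖n‖ ^ 2) • n = inner ℝ v e • e := by
    rw [he, inner_smul_right, smul_smul]; congr 1; field_simp
  have h1' : (inner ℝ v' n' / ‖n'‖ ^ 2) • n' = inner ℝ v' e' • e' := by
    rw [he', inner_smul_right, smul_smul]; congr 1; field_simp
  have hne : ‖e‖ = 1 := by rw [he, norm_smul, norm_inv, norm_norm]; field_simp
  have hne' : ‖e'‖ = 1 := by rw [he', norm_smul, norm_inv, norm_norm]; field_simp
  have hM : 0 ≤ M := (norm_nonneg _).trans hv'
  have hee : ‖e - e'‖ ≤ 2 / c * ‖n - n'‖ := by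
    have : ‖n‖ • (e - e') = (n - n') + (‖n'‖ - ‖n‖) • e' := by
      have a : ‖n‖ • e = n := by rw [he, smul_smul, mul_inv_cancel₀ hn0.ne', one_smul]
      have b : ‖n'‖ • e' = n' := by rw [he', smul_smul, mul_inv_cancel₀ hn0'.ne', one_smul]
      rw [smul_sub, sub_smul, a, b]; abel
    have h2 : ‖n‖ * ‖e - e'‖ ≤ 2 * ‖n - n'‖ := by
      calc ‖n‖ * ‖e - e'‖ = ‖‖n‖ • (e - e')‖ := by rw [norm_smul, norm_norm]
        _ ≤ ‖n - n'‖ + ‖(‖n'‖ - ‖n‖) • e'‖ := by rw [this]; exact norm_add_le _ _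
        _ ≤ ‖n - n'‖ + ‖n - n'‖ := by
            gcongr
            rw [norm_smul, hne', mul_one, Real.norm_eq_abs, norm_sub_rev n n']
            exact abs_norm_sub_norm_le _ _
        _ = 2 * ‖n - n'‖ := by ring
    rw [div_mul_eq_mul_div, le_div_iff₀ hc]
    nlinarith [norm_nonneg (e - e')]
  have key : inner ℝ v e • e - inner ℝ v' e' • e'
      = inner ℝ (v - v') e • e + inner ℝ v' (e - e') • e + inner ℝ v' e' • (e - e') := by
    rw [inner_sub_left, inner_sub_right]; module
  have b1 : ‖inner ℝ (v - v') e • e‖ ≤ ‖v - v'‖ := by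
    rw [norm_smul, hne, mul_one]
    simpa [hne] using norm_inner_le_norm (𝕜 := ℝ) (v - v') e
  have b2 : ‖inner ℝ v' (e - e') • e‖ ≤ M * ‖e - e'‖ := by
    rw [norm_smul, hne, mul_one]
    exact (norm_inner_le_norm v' (e - e')).trans (by gcongr)
  have b3 : ‖inner ℝ v' e' • (e - e')‖ ≤ M * ‖e - e'‖ := by
    rw [norm_smul]
    gcongr
    refine (norm_inner_le_norm (𝕜 := ℝ) v' e').trans ?_
    rw [hne', mul_one]; exact hv'
  rw [h1, h1', key]
  calc _ ≤ ‖v - v'‖ + M * ‖e - e'‖ + M * ‖e - e'‖ :=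
        (norm_add₃_le).trans (by gcongr)
    _ = ‖v - v'‖ + 2 * M * ‖e - e'‖ := by ring
    _ ≤ ‖v - v'‖ + 2 * M * (2 / c * ‖n - n'‖) := by gcongr
    _ = _ := by ring

theorem norm_damping_le (θ : ℝ) (x v : Plane) : ‖damping θ x v‖ ≤ ‖v‖ := by
  rw [damping_eq]
  set n := x - projCone θ x
  rcases eq_or_ne n 0 with h | h
  · simp [h]
  have h' : 0 < ‖n‖ := norm_pos_iff.2 h
  rw [norm_smul, norm_div, norm_pow, norm_norm]
  calc ‖inner ℝ v n‖ / ‖n‖ ^ 2 * ‖n‖ ≤ (‖v‖ * ‖n‖) / ‖n‖ ^ 2 * ‖n‖ := by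
        gcongr; exact norm_inner_le_norm _ _
    _ = ‖v‖ := by field_simp

theorem norm_penaltyForce_le {α k : ℝ} (hα : 0 ≤ α) (hk : 0 ≤ k) (θ : ℝ) (x v : Plane) :
    ‖penaltyForce θ α k x v‖ ≤ 2 * α * √k * ‖v‖ + k * ‖x‖ := by
  unfold penaltyForce
  refine (norm_add_le _ _).trans ?_
  rw [norm_smul, norm_smul, Real.norm_of_nonneg (by positivity), Real.norm_of_nonneg hk]
  gcongr
  · exact norm_damping_le θ x v
  · exact norm_sub_projCone_le θ x

/-- The first coordinate of a point bounds from below its distance to the cone. -/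
theorem apply_zero_le_norm_residual (θ : ℝ) (x : Plane) : x 0 ≤ ‖x - projCone θ x‖ := by
  have h := (projCone_mem θ x).1
  have h2 : (x - projCone θ x) 0 ≤ ‖x - projCone θ x‖ :=
    (Real.le_norm_self _).trans (PiLp.norm_apply_le _ _)
  simp only [PiLp.sub_apply] at h2
  linarith

theorem norm_penaltyForce_sub_le {α k c M : ℝ} (hα : 0 ≤ α) (hk : 0 ≤ k) (hc : 0 < c) (θ : ℝ)
    {x x' v v' : Plane} (hx : c ≤ x 0) (hx' : c ≤ x' 0) (hv' : ‖v'‖ ≤ M) :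
    ‖penaltyForce θ α k x v - penaltyForce θ α k x' v'‖
      ≤ 2 * α * √k * ‖v - v'‖ + (2 * α * √k * (4 * M / c) + k) * ‖x - x'‖ := by
  have hM : 0 ≤ M := (norm_nonneg _).trans hv'
  have h1 := norm_component_sub_le (v := v) hc (hx.trans (apply_zero_le_norm_residual θ x))
    (hx'.trans (apply_zero_le_norm_residual θ x')) hv'
  rw [← damping_eq, ← damping_eq] at h1
  have h2 := norm_residual_sub_le θ x x'
  have e : penaltyForce θ α k x v - penaltyForce θ α k x' v'
      = (2 * α * √k) • (damping θ x v - damping θ x' v')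
        + k • ((x - projCone θ x) - (x' - projCone θ x')) := by
    unfold penaltyForce; module
  rw [e]
  refine (norm_add_le _ _).trans ?_
  rw [norm_smul, norm_smul, Real.norm_of_nonneg (by positivity), Real.norm_of_nonneg hk]
  calc _ ≤ 2 * α * √k * (‖v - v'‖ + 4 * M / c * ‖x - x'‖) + k * ‖x - x'‖ := by
        gcongr
        exact h1.trans (by gcongr)
    _ = _ := by ring

/-! ### The two sides of the cone and the force facing them -/

/-- `n` is the unit outer normal of a side of the cone and `τ` the unit vector along that side
pointing away from the apex. -/
structure IsSide (θ : ℝ) (n τ : Plane) : Prop where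
  norm_normal : ‖n‖ = 1
  norm_tangent : ‖τ‖ = 1
  inner_eq_zero : inner ℝ n τ = 0
  decomp : ∀ x : Plane, x = inner ℝ x n • n + inner ℝ x τ • τ
  tangent_mem : ∀ c : ℝ, 0 ≤ c → c • τ ∈ cone θ
  inner_normal_le : ∀ z ∈ cone θ, inner ℝ z n ≤ 0

theorem isSide_first {θ : ℝ} (hs : 0 < Real.sin θ) :
    IsSide θ !₂[1, 0] !₂[0, -1] where
  norm_normal := by simp [EuclideanSpace.norm_eq]
  norm_tangent := by simp [EuclideanSpace.norm_eq]
  inner_eq_zero := by simp [PiLp.inner_apply]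
  decomp x := by ext i; fin_cases i <;> simp [PiLp.inner_apply]
  tangent_mem c hc := by simp [cone]; positivity
  inner_normal_le z hz := by simpa [PiLp.inner_apply] using hz.1

theorem isSide_second {θ : ℝ} (hs : 0 < Real.sin θ) :
    IsSide θ !₂[Real.cos θ, Real.sin θ] !₂[-Real.sin θ, Real.cos θ] where
  norm_normal := by simp [EuclideanSpace.norm_eq]
  norm_tangent := by simp [EuclideanSpace.norm_eq]
  inner_eq_zero := by simp [PiLp.inner_apply]; ring
  decomp x := by
    have h := Real.sin_sq_add_cos_sq θ
    ext i; fin_cases i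
    · simp [PiLp.inner_apply]; linear_combination (-x 0) * h
    · simp [PiLp.inner_apply]; linear_combination (-x 1) * h
  tangent_mem c hc := by
    refine ⟨?_, ?_⟩
    · simp; positivity
    · simp; linarith
  inner_normal_le z hz := by
    have := hz.2
    simp [PiLp.inner_apply]; linarith

/-- A nonnegative tangential coordinate puts the foot of the perpendicular on the side itself rather
than beyond the apex. The supporting half-plane shows that this foot is the nearest point, so the
residual is a multiple of `n` and the equation becomes linear. -/
theorem IsSide.penaltyForce_eq {θ : ℝ} {n τ : Plane} (h : IsSide θ n τ) (α k : ℝ) {x v : Plane}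
    (hn : 0 < inner ℝ x n) (hτ : 0 ≤ inner ℝ x τ) :
    penaltyForce θ α k x v = (2 * α * √k * inner ℝ v n + k * inner ℝ x n) • n := by
  have hr : x - inner ℝ x τ • τ = inner ℝ x n • n := by
    nth_rewrite 1 [h.decomp x]; abel
  have hP : projCone θ x = inner ℝ x τ • τ := by
    refine projCone_eq (h.tangent_mem _ hτ) fun z hz => ?_
    rw [dist_eq_norm, dist_eq_norm, hr, norm_smul, h.norm_normal, mul_one,
      Real.norm_of_nonneg hn.le]
    have h1 : inner ℝ (x - z) n ≤ ‖x - z‖ := by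
      simpa [h.norm_normal] using real_inner_le_norm (x - z) n
    rw [inner_sub_left] at h1
    linarith [h.inner_normal_le z hz]
  unfold penaltyForce
  rw [damping_eq, hP, hr, inner_smul_right, norm_smul, h.norm_normal, smul_smul, smul_smul,
    smul_smul, ← add_smul, mul_one, Real.norm_of_nonneg hn.le]
  congr 1
  field_simp

/-! ### The overdamped scalar equation -/

/-- The solution of `ÿ + (l + m) ẏ + l m y = 0` with `y(0) = y` and `ẏ(0) = w`. -/
noncomputable def dampedPos (l m y w t : ℝ) : ℝ :=
  y * Real.exp (-l * t) + (w + l * y) * ((Real.exp (-l * t) - Real.exp (-m * t)) / (m - l))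

/-- The velocity of `dampedPos`. -/
noncomputable def dampedVel (l m y w t : ℝ) : ℝ :=
  (w + l * y) * Real.exp (-m * t) - l * dampedPos l m y w t

theorem dampedPos_zero (l m y w : ℝ) : dampedPos l m y w 0 = y := by simp [dampedPos]

theorem dampedVel_zero (l m y w : ℝ) : dampedVel l m y w 0 = w := by
  simp [dampedVel, dampedPos_zero]

theorem hasDerivAt_exp_mul (c t : ℝ) :
    HasDerivAt (fun t => Real.exp (c * t)) (c * Real.exp (c * t)) t := by
  simpa [mul_comm] using ((hasDerivAt_id t).const_mul c).exp

theorem hasDerivAt_dampedPos {l m : ℝ} (hlm : l < m) (y w t : ℝ) :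
    HasDerivAt (dampedPos l m y w) (dampedVel l m y w t) t := by
  have h := ((hasDerivAt_exp_mul (-l) t).const_mul y).add
    ((((hasDerivAt_exp_mul (-l) t).sub (hasDerivAt_exp_mul (-m) t)).div_const (m - l)).const_mul
      (w + l * y))
  refine h.congr_deriv ?_
  have : m - l ≠ 0 := (sub_pos.2 hlm).ne'
  unfold dampedVel dampedPos
  field_simp
  ring

theorem hasDerivAt_dampedVel {l m : ℝ} (hlm : l < m) (y w t : ℝ) :
    HasDerivAt (dampedVel l m y w)
      (-((l + m) * dampedVel l m y w t + l * m * dampedPos l m y w t)) t := by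
  have h := ((hasDerivAt_exp_mul (-m) t).const_mul (w + l * y)).sub
    ((hasDerivAt_dampedPos hlm y w t).const_mul l)
  refine h.congr_deriv ?_
  unfold dampedVel
  ring

/-- The slow exponential dominates the fast one, so an outward start never comes back to zero: the
point does not re-enter the cone through the side. -/
theorem dampedPos_pos {l m y w t : ℝ} (hl : 0 ≤ l) (hlm : l < m) (hy : 0 ≤ y) (hw : 0 < w)
    (ht : 0 < t) : 0 < dampedPos l m y w t := by
  have h1 : Real.exp (-m * t) < Real.exp (-l * t) := Real.exp_lt_exp.2 (by nlinarith)
  have h2 : 0 < (Real.exp (-l * t) - Real.exp (-m * t)) / (m - l) :=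
    div_pos (sub_pos.2 h1) (sub_pos.2 hlm)
  unfold dampedPos
  positivity

/-- The fast exponential is discarded. With `y = 0` and `m - l` of order `√k`, this gives both the
`O(1/√k)` bound and the exponential decay. -/
theorem dampedPos_le {l m y w t : ℝ} (hl : 0 ≤ l) (hlm : l < m) (hy : 0 ≤ y) (hw : 0 ≤ w) :
    dampedPos l m y w t ≤ (y + (w + l * y) / (m - l)) * Real.exp (-l * t) := by
  have h0 : 0 < m - l := sub_pos.2 hlm
  have h1 : (Real.exp (-l * t) - Real.exp (-m * t)) / (m - l) ≤ Real.exp (-l * t) / (m - l) := by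
    gcongr
    linarith [Real.exp_pos (-m * t)]
  calc dampedPos l m y w t
      ≤ y * Real.exp (-l * t) + (w + l * y) * (Real.exp (-l * t) / (m - l)) := by
        unfold dampedPos; gcongr
    _ = _ := by ring

theorem eq_left_of_hasDerivWithinAt_zero {E : Type*} [NormedAddCommGroup E] [NormedSpace ℝ E]
    {f : ℝ → E} {a b : ℝ} (h : ∀ t ∈ Set.Icc a b, HasDerivWithinAt f 0 (Set.Icc a b) t) :
    ∀ t ∈ Set.Icc a b, f t = f a :=
  constant_of_has_deriv_right_zero (fun t ht => (h t ht).continuousWithinAt) fun t ht =>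
    (h t (Set.Ico_subset_Icc_self ht)).mono_of_mem_nhdsWithin (Icc_mem_nhdsGE_of_mem ht)

theorem hasDerivWithinAt_of_eq_sub_integral {w f : ℝ → ℝ} {a b : ℝ}
    (hf : ContinuousOn f (Set.Icc a b)) (hw : ∀ t ∈ Set.Icc a b, w t = w a - ∫ s in a..t, f s) :
    ∀ t ∈ Set.Icc a b, HasDerivWithinAt w (-f t) (Set.Icc a b) t := by
  intro t ht
  have : Fact (t ∈ Set.Icc a b) := ⟨ht⟩
  have hI : HasDerivWithinAt (fun t => ∫ s in a..t, f s) (f t) (Set.Icc a b) t := by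
    refine intervalIntegral.integral_hasDerivWithinAt_right ?_
      (hf.stronglyMeasurableAtFilter_nhdsWithin measurableSet_Icc t) (hf t ht)
    refine (hf.mono ?_).intervalIntegrable
    rw [Set.uIcc_of_le ht.1]
    exact Set.Icc_subset_Icc_right ht.2
  exact (hI.const_sub (w a)).congr_of_mem hw ht

/-- The operator factors as `(d/dt + m)(d/dt + l)`. The difference from the explicit solution is
killed by two integrating factors in turn, `exp (m t)` for `w + l y` and then `exp (l t)` for `y`.
-/
theorem eq_damped {l m a b : ℝ} (hlm : l < m) {y w : ℝ → ℝ}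
    (hy : ∀ t ∈ Set.Icc a b, HasDerivWithinAt y (w t) (Set.Icc a b) t)
    (hwc : ContinuousOn w (Set.Icc a b))
    (hw : ∀ t ∈ Set.Icc a b, w t = w a - ∫ s in a..t, ((l + m) * w s + l * m * y s)) :
    ∀ t ∈ Set.Icc a b, y t = dampedPos l m (y a) (w a) (t - a) ∧
      w t = dampedVel l m (y a) (w a) (t - a) := by
  have hyc : ContinuousOn y (Set.Icc a b) := fun t ht => (hy t ht).continuousWithinAt
  have hw' := hasDerivWithinAt_of_eq_sub_integral (f := fun s => (l + m) * w s + l * m * y s)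
    (by fun_prop) hw
  have hp (t : ℝ) : HasDerivAt (fun t => dampedPos l m (y a) (w a) (t - a))
      (dampedVel l m (y a) (w a) (t - a)) t :=
    (hasDerivAt_dampedPos hlm (y a) (w a) (t - a)).comp_sub_const t a
  have hv (t : ℝ) := (hasDerivAt_dampedVel hlm (y a) (w a) (t - a)).comp_sub_const t a
  set p := fun t => dampedPos l m (y a) (w a) (t - a) with hpdef
  set v := fun t => dampedVel l m (y a) (w a) (t - a) with hvdef
  have hpa : p a = y a := by simp [hpdef, dampedPos_zero]
  have hva : v a = w a := by simp [hvdef, dampedVel_zero]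
  have hq : ∀ t ∈ Set.Icc a b, (w t - v t + l * (y t - p t)) * Real.exp (m * t) = 0 := by
    intro t ht
    have := eq_left_of_hasDerivWithinAt_zero
      (f := fun t => (w t - v t + l * (y t - p t)) * Real.exp (m * t)) (a := a) (b := b)
      (fun t ht => ((((hw' t ht).sub (hv t).hasDerivWithinAt).add
        (((hy t ht).sub (hp t).hasDerivWithinAt).const_mul l)).mul
          (hasDerivAt_exp_mul m t).hasDerivWithinAt).congr_deriv (by
            simp only [Pi.add_apply, Pi.sub_apply, hpdef, hvdef]; ring)) t ht
    rw [this, hpa, hva]; simp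
  have hq' : ∀ t ∈ Set.Icc a b, w t - v t = -l * (y t - p t) := fun t ht => by
    have := (mul_eq_zero.1 (hq t ht)).resolve_right (Real.exp_ne_zero _)
    linarith
  have hd : ∀ t ∈ Set.Icc a b, (y t - p t) * Real.exp (l * t) = 0 := by
    intro t ht
    have := eq_left_of_hasDerivWithinAt_zero
      (f := fun t => (y t - p t) * Real.exp (l * t)) (a := a) (b := b)
      (fun t ht => (((hy t ht).sub (hp t).hasDerivWithinAt).mul
          (hasDerivAt_exp_mul l t).hasDerivWithinAt).congr_deriv (by
            have := hq' t ht
            simp only [Pi.sub_apply]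
            linear_combination Real.exp (l * t) * this)) t ht
    rw [this, hpa]; simp
  intro t ht
  have h1 : y t - p t = 0 := (mul_eq_zero.1 (hd t ht)).resolve_right (Real.exp_ne_zero _)
  have h2 := hq' t ht
  rw [h1] at h2
  exact ⟨sub_eq_zero.1 h1, by linarith⟩

/-! ### Motions in integral form and their rigidity along a side -/

/-- A continuous curve that enters an open set immediately and cannot leave it at a first time
remains in it. -/
theorem mem_of_forall_not_first_exit {E : Type*} [TopologicalSpace E] {f : ℝ → E} {R : Set E}
    {a b : ℝ} (hf : ContinuousOn f (Set.Icc a b)) (hR : IsOpen R)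
    (hstart : ∀ᶠ t in 𝓝[>] a, f t ∈ R)
    (hstep : ∀ t ∈ Set.Ioc a b, (∀ s ∈ Set.Ioo a t, f s ∈ R) → f t ∈ R) :
    ∀ t ∈ Set.Ioc a b, f t ∈ R := by
  intro t ht
  by_contra hbad
  obtain ⟨c, hac, hc⟩ := (mem_nhdsGT_iff_exists_Ioo_subset' ht.1).1 hstart
  -- The search for a first bad time starts strictly after `a`, since `f a` itself may lie outside
  -- `R`.
  set d := min ((a + c) / 2) t
  have hac : a < c := hac
  have had : a < d := lt_min (by linarith) ht.1
  have hcl : IsClosed (Set.Icc d t ∩ f ⁻¹' Rᶜ) :=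
    (hf.mono (Set.Icc_subset_Icc had.le ht.2)).preimage_isClosed_of_isClosed isClosed_Icc
      hR.isClosed_compl
  have hcomp : IsCompact (Set.Icc d t ∩ f ⁻¹' Rᶜ) :=
    isCompact_Icc.of_isClosed_subset hcl Set.inter_subset_left
  obtain ⟨τ, ⟨hτ, hτR⟩, hmin⟩ := hcomp.exists_isLeast ⟨t, ⟨min_le_right _ _, le_rfl⟩, hbad⟩
  refine hτR (hstep τ ⟨had.trans_le hτ.1, hτ.2.trans ht.2⟩ fun s hs => ?_)
  rcases lt_or_ge s d with hsd | hsd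
  · exact hc ⟨hs.1, by linarith [min_le_left ((a + c) / 2) t]⟩
  · by_contra h
    exact absurd (hmin ⟨⟨hsd, hs.2.le.trans hτ.2⟩, h⟩) (not_le.2 hs.2)

/-- `u` moves on the time set `S` with velocity `v` according to the penalized equation, in integral
form from the time `a`. -/
structure IsMotionOn (θ α k a : ℝ) (S : Set ℝ) (u v : ℝ → Plane) : Prop where
  hasDeriv : ∀ t ∈ S, HasDerivWithinAt u (v t) S t
  continuousOn_vel : ContinuousOn v S
  integrable : ∀ t ∈ S, IntervalIntegrable (fun s => penaltyForce θ α k (u s) (v s)) volume a t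
  vel_eq : ∀ t ∈ S, v t = v a - ∫ s in a..t, penaltyForce θ α k (u s) (v s)

namespace IsMotionOn

variable {θ α k a b : ℝ} {S : Set ℝ} {u v : ℝ → Plane} {n τ : Plane}

theorem continuousOn_pos (h : IsMotionOn θ α k a S u v) : ContinuousOn u S :=
  fun t ht => (h.hasDeriv t ht).continuousWithinAt

theorem mono {S' : Set ℝ} (h : IsMotionOn θ α k a S u v) (hS : S' ⊆ S) :
    IsMotionOn θ α k a S' u v :=
  ⟨fun t ht => (h.hasDeriv t (hS ht)).mono hS, h.continuousOn_vel.mono hS,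
    fun t ht => h.integrable t (hS ht), fun t ht => h.vel_eq t (hS ht)⟩

theorem restart (h : IsMotionOn θ α k a (Set.Ici a) u v) (hab : a ≤ b) :
    IsMotionOn θ α k b (Set.Ici b) u v where
  hasDeriv t ht := (h.hasDeriv t (hab.trans ht)).mono (Set.Ici_subset_Ici.2 hab)
  continuousOn_vel := h.continuousOn_vel.mono (Set.Ici_subset_Ici.2 hab)
  integrable t ht := (h.integrable b hab).symm.trans (h.integrable t (hab.trans ht))
  vel_eq t ht := by
    have h1 := intervalIntegral.integral_add_adjacent_intervals (h.integrable b hab)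
      ((h.integrable b hab).symm.trans (h.integrable t (hab.trans ht)))
    rw [h.vel_eq b hab, h.vel_eq t (hab.trans ht), ← h1]
    abel

theorem inner_vel_eq (h : IsMotionOn θ α k a S u v) (e : Plane) {t : ℝ} (ht : t ∈ S) :
    inner ℝ (v t) e = inner ℝ (v a) e -
      ∫ s in a..t, inner ℝ (penaltyForce θ α k (u s) (v s)) e := by
  have := (innerSL ℝ e).intervalIntegral_comp_comm (h.integrable t ht)
  simp only [innerSL_apply_apply] at this
  simp only [real_inner_comm e]
  rw [this, h.vel_eq t ht, inner_sub_right]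

theorem hasDerivWithinAt_inner (h : IsMotionOn θ α k a S u v) (e : Plane) {t : ℝ} (ht : t ∈ S) :
    HasDerivWithinAt (fun t => inner ℝ (u t) e) (inner ℝ (v t) e) S t := by
  simpa using (h.hasDeriv t ht).inner ℝ (hasDerivWithinAt_const t S e)

/-- Only the open time interval matters: at the endpoints the point may sit on the boundary, where
the force jumps, but the integrals do not see them. -/
theorem eq_of_mem_side {l m : ℝ} (h : IsMotionOn θ α k a (Set.Icc a b) u v)
    (hs : IsSide θ n τ) (hlm : l < m) (hadd : l + m = 2 * α * √k) (hmul : l * m = k)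
    (hu : ∀ s ∈ Set.Ioo a b, 0 < inner ℝ (u s) n ∧ 0 ≤ inner ℝ (u s) τ) :
    ∀ t ∈ Set.Icc a b,
      inner ℝ (u t) n = dampedPos l m (inner ℝ (u a) n) (inner ℝ (v a) n) (t - a) ∧
      inner ℝ (v t) n = dampedVel l m (inner ℝ (u a) n) (inner ℝ (v a) n) (t - a) ∧
      inner ℝ (u t) τ = inner ℝ (u a) τ + (t - a) * inner ℝ (v a) τ ∧
      inner ℝ (v t) τ = inner ℝ (v a) τ := by
  have hforce : ∀ s ∈ Set.Ioo a b, penaltyForce θ α k (u s) (v s)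
      = ((l + m) * inner ℝ (v s) n + l * m * inner ℝ (u s) n) • n := fun s hs' => by
    rw [hs.penaltyForce_eq α k (hu s hs').1 (hu s hs').2, hadd, hmul]
  have hn := eq_damped hlm (y := fun t => inner ℝ (u t) n) (w := fun t => inner ℝ (v t) n)
    (fun t ht => h.hasDerivWithinAt_inner n ht)
    (h.continuousOn_vel.inner continuousOn_const) fun t ht => by
      rw [h.inner_vel_eq n ht]
      congr 1
      refine intervalIntegral.integral_congr_Ioo_of_le ht.1 fun s hs' => ?_
      rw [hforce s ⟨hs'.1, hs'.2.trans_le ht.2⟩, inner_smul_left, real_inner_self_eq_norm_sq,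
        hs.norm_normal]
      simp
  have hτ : ∀ t ∈ Set.Icc a b, inner ℝ (v t) τ = inner ℝ (v a) τ := fun t ht => by
    rw [h.inner_vel_eq τ ht]
    have : ∫ s in a..t, inner ℝ (penaltyForce θ α k (u s) (v s)) τ = ∫ s in a..t, (0 : ℝ) := by
      refine intervalIntegral.integral_congr_Ioo_of_le ht.1 fun s hs' => ?_
      rw [hforce s ⟨hs'.1, hs'.2.trans_le ht.2⟩, inner_smul_left, hs.inner_eq_zero, mul_zero]
    rw [this]; simp
  have hz : ∀ t ∈ Set.Icc a b,
      inner ℝ (u t) τ - (t - a) * inner ℝ (v a) τ = inner ℝ (u a) τ := fun t ht => by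
    have := eq_left_of_hasDerivWithinAt_zero
      (f := fun t => inner ℝ (u t) τ - (t - a) * inner ℝ (v a) τ) (a := a) (b := b)
      (fun t ht => ((h.hasDerivWithinAt_inner τ ht).sub
        (((hasDerivAt_id t).sub_const a).mul_const
          (inner ℝ (v a) τ)).hasDerivWithinAt).congr_deriv (by rw [hτ t ht]; simp)) t ht
    simpa using this
  exact fun t ht => ⟨(hn t ht).1, (hn t ht).2, by linarith [hz t ht], hτ t ht⟩

/-- A motion starting on the side is not yet in the open region facing it; the outward velocity
brings it there at once. -/
theorem eventually_inner_pos (h : IsMotionOn θ α k a (Set.Icc a b) u v) (hab : a < b)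
    (hy : 0 ≤ inner ℝ (u a) n) (hw : 0 < inner ℝ (v a) n) :
    ∀ᶠ t in 𝓝[>] a, 0 < inner ℝ (u t) n := by
  have hd := (h.hasDerivWithinAt_inner n (Set.left_mem_Icc.2 hab.le)).mono_of_mem_nhdsWithin
    (s := Set.Ioi a) (Icc_mem_nhdsGT hab)
  have hs := (hasDerivWithinAt_iff_tendsto_slope' (by simp)).1 hd
  filter_upwards [hs.eventually_const_lt hw, self_mem_nhdsWithin] with t ht hta
  have hta : 0 < t - a := sub_pos.2 hta
  rw [slope_def_field] at ht
  have := (div_pos_iff_of_pos_right hta).1 ht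
  linarith

/-- A motion that starts on a side of the cone with an outward velocity is overdamped in the normal
direction and free in the tangential direction as long as it does not pass the apex. -/
theorem eq_on_side {l m : ℝ} (h : IsMotionOn θ α k a (Set.Icc a b) u v) (hab : a < b)
    (hs : IsSide θ n τ) (hl : 0 ≤ l) (hlm : l < m) (hadd : l + m = 2 * α * √k) (hmul : l * m = k)
    (hy : 0 ≤ inner ℝ (u a) n) (hw : 0 < inner ℝ (v a) n)
    (hz : ∀ t ∈ Set.Ico a b, 0 < inner ℝ (u a) τ + (t - a) * inner ℝ (v a) τ) :
    ∀ t ∈ Set.Icc a b,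
      inner ℝ (u t) n = dampedPos l m (inner ℝ (u a) n) (inner ℝ (v a) n) (t - a) ∧
      inner ℝ (v t) n = dampedVel l m (inner ℝ (u a) n) (inner ℝ (v a) n) (t - a) ∧
      inner ℝ (u t) τ = inner ℝ (u a) τ + (t - a) * inner ℝ (v a) τ ∧
      inner ℝ (v t) τ = inner ℝ (v a) τ := by
  refine h.eq_of_mem_side hs hlm hadd hmul fun s hsab => ?_
  have hc (e : Plane) : Continuous fun x : Plane => inner ℝ x e := by fun_prop
  have hR : IsOpen {x : Plane | 0 < inner ℝ x n ∧ 0 < inner ℝ x τ} :=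
    (isOpen_lt continuous_const (hc n)).inter (isOpen_lt continuous_const (hc τ))
  have hsub : Set.Icc a s ⊆ Set.Icc a b := Set.Icc_subset_Icc_right hsab.2.le
  -- Continuation: as long as the point faces the side, the explicit formulas hold, and they are
  -- strictly positive at any candidate first exit time.
  have := mem_of_forall_not_first_exit (h.continuousOn_pos.mono hsub) hR ?_ ?_ s ⟨hsab.1, le_rfl⟩
  · exact ⟨this.1, this.2.le⟩
  · have h0 := hz a ⟨le_rfl, hab⟩
    have hc : Tendsto (fun t => inner ℝ (u t) τ) (𝓝[>] a) (𝓝 (inner ℝ (u a) τ)) :=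
      ((h.hasDerivWithinAt_inner τ (Set.left_mem_Icc.2 hab.le)).mono_of_mem_nhdsWithin
        (s := Set.Ioi a) (Icc_mem_nhdsGT hab)).continuousWithinAt
    filter_upwards [h.eventually_inner_pos hab hy hw,
      hc.eventually_const_lt (u := 0) (by simpa using h0)] with t h1 h2 using ⟨h1, h2⟩
  · intro t ht hts
    have htb : t < b := ht.2.trans_lt hsab.2
    obtain ⟨e1, -, e3, -⟩ := (h.mono (Set.Icc_subset_Icc_right htb.le)).eq_of_mem_side hs hlm hadd
      hmul (fun s hs' => ⟨(hts s hs').1, (hts s hs').2.le⟩) t ⟨ht.1.le, le_rfl⟩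
    refine ⟨?_, ?_⟩
    · rw [e1]; exact dampedPos_pos hl hlm hy hw (sub_pos.2 ht.1)
    · rw [e3]; exact hz t ⟨ht.1.le, htb⟩

end IsMotionOn

/-! ### Velocity control, concatenation and explicit motions -/

section Construction

variable {θ α k a b : ℝ}

namespace IsMotionOn

variable {u v : ℝ → Plane}

theorem norm_sub_affine_le (h : IsMotionOn θ α k a (Set.Icc a b) u v) {w : Plane} {σ : ℝ}
    (hv : ∀ s ∈ Set.Ico a b, ‖v s - w‖ ≤ σ) :
    ∀ t ∈ Set.Icc a b, ‖u t - (u a + (t - a) • w)‖ ≤ σ * (t - a) := by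
  intro t ht
  have hd : ∀ t ∈ Set.Icc a b, HasDerivWithinAt (fun t => u t - (t - a) • w) (v t - w)
      (Set.Icc a b) t := fun t ht => by
    have := (((hasDerivAt_id t).sub_const a).smul_const w).hasDerivWithinAt (s := Set.Icc a b)
    exact ((h.hasDeriv t ht).sub this).congr_deriv (by simp)
  have := norm_image_sub_le_of_norm_deriv_le_segment' hd hv t ht
  have e : u t - (u a + (t - a) • w) = u t - (t - a) • w - (u a - (a - a) • w) := by
    rw [sub_self, zero_smul, sub_zero]; abel
  rw [e]
  exact this

/-- Over a short time, the velocity stays close to a constant. -/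
theorem norm_vel_sub_lt (h : IsMotionOn θ α k a (Set.Icc a b) u v) (hab : a ≤ b) (hα : 0 ≤ α)
    (hk : 0 ≤ k) {w : Plane} {σ : ℝ} (hσ0 : 0 ≤ σ)
    (hσ : ‖v a - w‖ + (b - a) * (2 * α * √k * (‖w‖ + σ) + k * (‖u a‖ + (b - a) * (‖w‖ + σ))) < σ) :
    ∀ t ∈ Set.Icc a b, ‖v t - w‖ < σ := by
  have hba : 0 ≤ b - a := sub_nonneg.2 hab
  have hM : 0 ≤ 2 * α * √k * (‖w‖ + σ) + k * (‖u a‖ + (b - a) * (‖w‖ + σ)) := by positivity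
  have ha : ‖v a - w‖ < σ := by nlinarith
  have hR : IsOpen {x : Plane | ‖x - w‖ < σ} := isOpen_lt (by fun_prop) (by fun_prop)
  intro t ht
  rcases ht.1.eq_or_lt with rfl | hat
  · exact ha
  have hab' : a < b := hat.trans_le ht.2
  -- While the velocity stays `σ`-close to `w`, the force is bounded by the bracket in `hσ`;
  -- integrated over a time at most `b - a`, it leaves the deviation strictly below `σ`.
  refine mem_of_forall_not_first_exit h.continuousOn_vel hR ?_ ?_ t ⟨hat, ht.2⟩
  · have hc : Tendsto v (𝓝[>] a) (𝓝 (v a)) :=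
      (h.continuousOn_vel a (Set.left_mem_Icc.2 hab)).mono_of_mem_nhdsWithin (Icc_mem_nhdsGT hab')
    exact hc (hR.mem_nhds ha)
  · intro t ht hts
    have hsub : Set.Icc a t ⊆ Set.Icc a b := Set.Icc_subset_Icc_right ht.2
    have hv : ∀ s ∈ Set.Ico a t, ‖v s - w‖ ≤ σ := fun s hs => by
      rcases hs.1.eq_or_lt with rfl | has
      · exact ha.le
      · exact (hts s ⟨has, hs.2⟩).le
    have hu := (h.mono hsub).norm_sub_affine_le hv
    have hF : ∀ s ∈ Set.Ioo a t, ‖penaltyForce θ α k (u s) (v s)‖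
        ≤ 2 * α * √k * (‖w‖ + σ) + k * (‖u a‖ + (b - a) * (‖w‖ + σ)) := fun s hs => by
      refine (norm_penaltyForce_le hα hk θ _ _).trans ?_
      have h1 : ‖v s‖ ≤ ‖w‖ + σ := by
        calc ‖v s‖ = ‖w + (v s - w)‖ := by congr 1; abel
          _ ≤ ‖w‖ + σ := (norm_add_le _ _).trans (by gcongr; exact hv s ⟨hs.1.le, hs.2⟩)
      have hsa : 0 ≤ s - a := sub_nonneg.2 hs.1.le
      have hsb : s - a ≤ b - a := by linarith [hs.2, ht.2]
      have h2 : ‖u s‖ ≤ ‖u a‖ + (b - a) * (‖w‖ + σ) := by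
        calc ‖u s‖ = ‖u a + (s - a) • w + (u s - (u a + (s - a) • w))‖ := by congr 1; abel
          _ ≤ ‖u a‖ + ‖(s - a) • w‖ + ‖u s - (u a + (s - a) • w)‖ := norm_add₃_le
          _ ≤ ‖u a‖ + (s - a) * ‖w‖ + σ * (s - a) := by
              rw [norm_smul, Real.norm_of_nonneg hsa]
              gcongr
              exact hu s ⟨hs.1.le, hs.2.le⟩
          _ = ‖u a‖ + (s - a) * (‖w‖ + σ) := by ring
          _ ≤ _ := by gcongr
      gcongr
    have hI : ‖v t - v a‖
        ≤ (2 * α * √k * (‖w‖ + σ) + k * (‖u a‖ + (b - a) * (‖w‖ + σ))) * |t - a| := by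
      have e : v t - v a = -∫ s in a..t, penaltyForce θ α k (u s) (v s) := by
        rw [h.vel_eq t (hsub ⟨ht.1.le, le_rfl⟩)]; abel
      rw [e, norm_neg]
      refine intervalIntegral.norm_integral_le_of_norm_le_const_ae ?_
      -- The endpoint `t` is a null set, and the velocity bound is known only before it.
      filter_upwards [Measure.ae_ne volume t] with s hs hs'
      rw [Set.uIoc_of_le ht.1.le] at hs'
      exact hF s ⟨hs'.1, lt_of_le_of_ne hs'.2 hs⟩
    rw [abs_of_nonneg (sub_nonneg.2 ht.1.le)] at hI
    have : ‖v t - w‖ ≤ ‖v a - w‖ + ‖v t - v a‖ := by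
      calc ‖v t - w‖ = ‖(v a - w) + (v t - v a)‖ := by congr 1; abel
        _ ≤ _ := norm_add_le _ _
    have hle : t - a ≤ b - a := by linarith [ht.2]
    change ‖v t - w‖ < σ
    nlinarith

/-- Concatenation of two motions. -/
theorem glue {u' v' : ℝ → Plane} (h : IsMotionOn θ α k a (Set.Icc a b) u v) (hab : a ≤ b)
    (h' : IsMotionOn θ α k b (Set.Ici b) u' v') (hu : u b = u' b) (hv : v b = v' b) :
    IsMotionOn θ α k a (Set.Ici a) (fun t => if t ≤ b then u t else u' t)
      (fun t => if t ≤ b then v t else v' t) := by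
  set U := fun t => if t ≤ b then u t else u' t with hU
  set V := fun t => if t ≤ b then v t else v' t with hV
  have eU : ∀ t ≤ b, U t = u t := fun t ht => if_pos ht
  have eV : ∀ t ≤ b, V t = v t := fun t ht => if_pos ht
  have eU' : ∀ t, b ≤ t → U t = u' t := fun t ht => by
    rcases ht.eq_or_lt with rfl | ht
    · rw [eU _ le_rfl, hu]
    · exact if_neg (not_le.2 ht)
  have eV' : ∀ t, b ≤ t → V t = v' t := fun t ht => by
    rcases ht.eq_or_lt with rfl | ht
    · rw [eV _ le_rfl, hv]
    · exact if_neg (not_le.2 ht)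
  have hun : Set.Icc a b ∪ Set.Ici b = Set.Ici a := Set.Icc_union_Ici_eq_Ici hab
  have hint : ∀ t ∈ Set.Icc a b,
      IntervalIntegrable (fun s => penaltyForce θ α k (U s) (V s)) volume a t := fun t ht => by
    refine (h.integrable t ht).congr fun s hs => ?_
    rw [Set.uIoc_of_le ht.1] at hs
    simp only [eU s (hs.2.trans ht.2), eV s (hs.2.trans ht.2)]
  have hint' : ∀ t, b ≤ t →
      IntervalIntegrable (fun s => penaltyForce θ α k (U s) (V s)) volume b t := fun t ht => by
    refine (h'.integrable t ht).congr fun s hs => ?_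
    rw [Set.uIoc_of_le ht] at hs
    simp only [eU' s hs.1.le, eV' s hs.1.le]
  have hvel : ∀ t ∈ Set.Icc a b, V t = V a - ∫ s in a..t, penaltyForce θ α k (U s) (V s) :=
    fun t ht => by
      rw [eV t ht.2, eV a hab, h.vel_eq t ht]
      congr 1
      refine intervalIntegral.integral_congr_Ioo_of_le ht.1 fun s hs => ?_
      rw [eU s (hs.2.le.trans ht.2), eV s (hs.2.le.trans ht.2)]
  have hvel' : ∀ t, b ≤ t → V t = V b - ∫ s in b..t, penaltyForce θ α k (U s) (V s) :=
    fun t ht => by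
      rw [eV' t ht, eV' b le_rfl, h'.vel_eq t ht]
      congr 1
      refine intervalIntegral.integral_congr_Ioo_of_le ht fun s hs => ?_
      rw [eU' s hs.1.le, eV' s hs.1.le]
  have hcl : ContinuousOn V (Set.Icc a b) :=
    h.continuousOn_vel.congr fun t ht => eV t ht.2
  have hcr : ContinuousOn V (Set.Ici b) := h'.continuousOn_vel.congr fun t ht => eV' t ht
  have hdl : ∀ t ∈ Set.Icc a b, HasDerivWithinAt U (V t) (Set.Icc a b) t := fun t ht => by
    rw [eV t ht.2]
    exact (h.hasDeriv t ht).congr_of_mem (fun s hs => eU s hs.2) ht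
  have hdr : ∀ t ∈ Set.Ici b, HasDerivWithinAt U (V t) (Set.Ici b) t := fun t ht => by
    rw [eV' t ht]
    exact (h'.hasDeriv t ht).congr_of_mem (fun s hs => eU' s hs) ht
  refine ⟨fun t ht => ?_, ?_, fun t ht => ?_, fun t ht => ?_⟩
  · rw [← hun]
    rcases lt_trichotomy t b with htb | rfl | htb
    · exact (hdl t ⟨ht, htb.le⟩).mono_of_mem_nhdsWithin (by
        rw [hun, mem_nhdsWithin]
        exact ⟨Set.Iio b, isOpen_Iio, htb, fun s hs => ⟨hs.2, hs.1.le⟩⟩)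
    · exact (hdl t ⟨hab, le_rfl⟩).union (hdr t Set.self_mem_Ici)
    · exact (hdr t htb.le).mono_of_mem_nhdsWithin (mem_nhdsWithin_of_mem_nhds (Ici_mem_nhds htb))
  · rw [← hun]
    exact hcl.union_of_isClosed hcr isClosed_Icc isClosed_Ici
  · rcases le_total t b with htb | htb
    · exact hint t ⟨ht, htb⟩
    · exact (hint b ⟨hab, le_rfl⟩).trans (hint' t htb)
  · rcases le_total t b with htb | htb
    · exact hvel t ⟨ht, htb⟩
    · rw [hvel' t htb, hvel b ⟨hab, le_rfl⟩, ← intervalIntegral.integral_add_adjacent_intervals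
        (hint b ⟨hab, le_rfl⟩) (hint' t htb)]
      abel

end IsMotionOn

/-- The explicit motion along a side of the cone. -/
theorem IsSide.isMotionOn {n τ : Plane} (hs : IsSide θ n τ) {l m y w z ζ : ℝ} {S : Set ℝ}
    (hl : 0 ≤ l) (hlm : l < m) (hadd : l + m = 2 * α * √k) (hmul : l * m = k) (hy : 0 ≤ y)
    (hw : 0 < w) (hS : ∀ t ∈ S, a ≤ t ∧ ∀ s ∈ Set.Ioc a t, 0 ≤ z + (s - a) * ζ) :
    IsMotionOn θ α k a S
      (fun t => dampedPos l m y w (t - a) • n + (z + (t - a) * ζ) • τ)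
      (fun t => dampedVel l m y w (t - a) • n + ζ • τ) := by
  have hp (t : ℝ) : HasDerivAt (fun t => dampedPos l m y w (t - a)) (dampedVel l m y w (t - a)) t :=
    (hasDerivAt_dampedPos hlm y w (t - a)).comp_sub_const t a
  have hv (t : ℝ) := (hasDerivAt_dampedVel hlm y w (t - a)).comp_sub_const t a
  have hvd (t : ℝ) : HasDerivAt (fun t => dampedVel l m y w (t - a) • n + ζ • τ)
      (-(((l + m) * dampedVel l m y w (t - a) + l * m * dampedPos l m y w (t - a)) • n)) t := by
    rw [← neg_smul]
    exact ((hv t).smul_const n).add_const _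
  have hgc : Continuous fun t =>
      -(((l + m) * dampedVel l m y w (t - a) + l * m * dampedPos l m y w (t - a)) • n) := by
    have h1 : Continuous fun t => dampedPos l m y w (t - a) :=
      continuous_iff_continuousAt.2 fun t => (hp t).continuousAt
    have h2 : Continuous fun t => dampedVel l m y w (t - a) :=
      continuous_iff_continuousAt.2 fun t => (hv t).continuousAt
    fun_prop
  have hnn : inner ℝ n n = 1 := by rw [real_inner_self_eq_norm_sq, hs.norm_normal]; norm_num
  have hττ : inner ℝ τ τ = 1 := by rw [real_inner_self_eq_norm_sq, hs.norm_tangent]; norm_num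
  have hnτ := hs.inner_eq_zero
  have hτn : inner ℝ τ n = 0 := by rw [real_inner_comm]; exact hnτ
  -- The double negation presents the force as minus the derivative found in `hvd`, ready for the
  -- fundamental theorem of calculus.
  have hforce : ∀ t ∈ S, ∀ s ∈ Set.Ioc a t,
      penaltyForce θ α k (dampedPos l m y w (s - a) • n + (z + (s - a) * ζ) • τ)
        (dampedVel l m y w (s - a) • n + ζ • τ)
      = - -(((l + m) * dampedVel l m y w (s - a) + l * m * dampedPos l m y w (s - a)) • n) := by
    intro t ht s hs'
    rw [hs.penaltyForce_eq]
    · simp only [inner_add_left, real_inner_smul_left, hnn, hτn, hadd, hmul]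
      simp
    · simp only [inner_add_left, real_inner_smul_left, hnn, hτn]
      simpa using dampedPos_pos hl hlm hy hw (sub_pos.2 hs'.1)
    · simp only [inner_add_left, real_inner_smul_left, hnτ, hττ]
      simpa using (hS t ht).2 s hs'
  refine ⟨fun t ht => ?_, fun t ht => (hvd t).continuousAt.continuousWithinAt, fun t ht => ?_,
    fun t ht => ?_⟩
  · have hz : HasDerivAt (fun t => z + (t - a) * ζ) ζ t := by
      simpa using (((hasDerivAt_id t).sub_const a).mul_const ζ).const_add z
    exact (((hp t).smul_const n).add (hz.smul_const τ)).hasDerivWithinAt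
  · refine (hgc.neg.intervalIntegrable a t).congr fun s hs' => ?_
    rw [Set.uIoc_of_le (hS t ht).1] at hs'
    exact (hforce t ht s hs').symm
  · have h1 := intervalIntegral.integral_eq_sub_of_hasDerivAt (a := a) (b := t) (fun s _ => hvd s)
      (hgc.intervalIntegrable a t)
    have h2 := intervalIntegral.integral_congr_Ioo_of_le (μ := volume) (hS t ht).1
      fun s hs' => hforce t ht s ⟨hs'.1, hs'.2.le⟩
    rw [h2, intervalIntegral.integral_neg, h1]
    abel

/-! ### Existence in a tube away from the cone -/

/-- The Picard-Lindelöf theorem, recording that the vector field is continuous along the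
solution. -/
theorem exists_hasDerivWithinAt_continuousOn {E : Type*} [NormedAddCommGroup E] [NormedSpace ℝ E]
    [CompleteSpace E] {f : ℝ → E → E} {tmin tmax : ℝ} {t₀ : Set.Icc tmin tmax} {x₀ x : E}
    {r₀ r L K : NNReal} (hf : IsPicardLindelof f t₀ x₀ r₀ r L K) (hx : x ∈ Metric.closedBall x₀ r) :
    ∃ g : ℝ → E, g t₀ = x ∧
      (∀ t ∈ Set.Icc tmin tmax, HasDerivWithinAt g (f t (g t)) (Set.Icc tmin tmax) t) ∧
      ContinuousOn (fun t => f t (g t)) (Set.Icc tmin tmax) := by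
  obtain ⟨γ, hγ⟩ := ODE.FunSpace.exists_isFixedPt_next hf hx
  refine ⟨γ.compProj, ?_, fun t ht => ?_, ODE.FunSpace.continuousOn_comp_compProj hf γ⟩
  · rw [ODE.FunSpace.compProj_val, ← hγ, ODE.FunSpace.next_apply₀]
  · refine (ODE.hasDerivWithinAt_picard_Icc t₀.2 hf.continuousOn_uncurry
      γ.continuous_compProj.continuousOn (fun _ _ => γ.compProj_mem_closedBall hf.mul_max_le)
      x ht).congr_of_mem (fun s hs => ?_) ht
    rw [ODE.FunSpace.compProj_of_mem hs]
    exact (ODE.FunSpace.isFixedPt_next_iff hf hx).1 hγ ⟨s, hs⟩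

/-- The position in a tube of radius `ρ` around the straight motion from `x₀` with velocity `w`, in
rescaled coordinates. -/
def tubePos (a ρ : ℝ) (x₀ w : Plane) (t : ℝ) (p : Plane × Plane) : Plane :=
  x₀ + (t - a) • w + ρ • p.1

/-- The velocity in a ball of radius `σ` around `w`, in rescaled coordinates. -/
def tubeVel (σ : ℝ) (w : Plane) (p : Plane × Plane) : Plane := w + σ • p.2

/-- The penalized equation in the rescaled coordinates of a tube. -/
noncomputable def tubeField (θ α k a ρ σ : ℝ) (x₀ w : Plane) (t : ℝ) (p : Plane × Plane) :
    Plane × Plane :=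
  ((σ / ρ) • p.2, -(σ⁻¹ • penaltyForce θ α k (tubePos a ρ x₀ w t p) (tubeVel σ w p)))

section Tube

variable {c ρ σ : ℝ} {x₀ w : Plane} {p q : Plane × Plane} {t s : ℝ}

theorem le_tubePos (hρ : 0 ≤ ρ) (htube : c + ρ ≤ (x₀ + (t - a) • w) 0) (hp : ‖p‖ ≤ 1) :
    c ≤ tubePos a ρ x₀ w t p 0 := by
  have h2 : |p.1 0| ≤ 1 := (PiLp.norm_apply_le p.1 0).trans ((norm_fst_le p).trans hp)
  have h3 : tubePos a ρ x₀ w t p 0 = (x₀ + (t - a) • w) 0 + ρ * p.1 0 := by simp [tubePos]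
  rw [h3]
  nlinarith [abs_le.1 h2]

theorem norm_tubeVel_le (hσ : 0 ≤ σ) (hp : ‖p‖ ≤ 1) : ‖tubeVel σ w p‖ ≤ ‖w‖ + σ := by
  refine (norm_add_le _ _).trans ?_
  rw [norm_smul, Real.norm_of_nonneg hσ]
  nlinarith [(norm_snd_le p).trans hp]

theorem norm_tubePos_le (hρ : 0 ≤ ρ) (ht : t ∈ Set.Icc a b) (hp : ‖p‖ ≤ 1) :
    ‖tubePos a ρ x₀ w t p‖ ≤ ‖x₀‖ + (b - a) * ‖w‖ + ρ := by
  refine norm_add₃_le.trans ?_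
  rw [norm_smul, norm_smul, Real.norm_of_nonneg hρ, Real.norm_of_nonneg (sub_nonneg.2 ht.1)]
  have h1 : t - a ≤ b - a := by linarith [ht.2]
  have h2 : ‖p.1‖ ≤ 1 := (norm_fst_le p).trans hp
  have h3 : ρ * ‖p.1‖ ≤ ρ := mul_le_of_le_one_right hρ h2
  gcongr

theorem norm_tubeField_le (hα : 0 ≤ α) (hk : 0 ≤ k) (hρ : 0 ≤ ρ) (hσ : 0 ≤ σ)
    (ht : t ∈ Set.Icc a b) (hp : ‖p‖ ≤ 1) :
    ‖tubeField θ α k a ρ σ x₀ w t p‖ ≤ max (σ / ρ)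
      (σ⁻¹ * (2 * α * √k * (‖w‖ + σ) + k * (‖x₀‖ + (b - a) * ‖w‖ + ρ))) := by
  refine norm_prod_le_iff.2 ⟨le_max_of_le_left ?_, le_max_of_le_right ?_⟩
  · rw [tubeField, norm_smul, Real.norm_of_nonneg (by positivity)]
    exact mul_le_of_le_one_right (by positivity) ((norm_snd_le p).trans hp)
  · rw [tubeField, norm_neg, norm_smul, Real.norm_of_nonneg (by positivity)]
    gcongr
    refine (norm_penaltyForce_le hα hk θ _ _).trans ?_
    have h1 := norm_tubeVel_le (w := w) hσ hp
    have h2 := norm_tubePos_le (x₀ := x₀) (w := w) hρ ht hp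
    gcongr

theorem norm_tubeField_sub_le (hα : 0 ≤ α) (hk : 0 ≤ k) (hc : 0 < c) (hρ : 0 ≤ ρ) (hσ : 0 ≤ σ)
    (htube : c + ρ ≤ (x₀ + (t - a) • w) 0) (hp : ‖p‖ ≤ 1) (hq : ‖q‖ ≤ 1) :
    ‖tubeField θ α k a ρ σ x₀ w t p - tubeField θ α k a ρ σ x₀ w t q‖ ≤
      (σ / ρ + σ⁻¹ * (2 * α * √k * σ + (2 * α * √k * (4 * (‖w‖ + σ) / c) + k) * ρ)) * ‖p - q‖ := by
  have hpq1 : ‖p.1 - q.1‖ ≤ ‖p - q‖ := norm_fst_le (p - q)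
  have hpq2 : ‖p.2 - q.2‖ ≤ ‖p - q‖ := norm_snd_le (p - q)
  have hfor := norm_penaltyForce_sub_le hα hk hc θ (v := tubeVel σ w p) (le_tubePos hρ htube hp)
    (le_tubePos hρ htube hq) (norm_tubeVel_le (w := w) hσ hq)
  have e1 : tubeVel σ w p - tubeVel σ w q = σ • (p.2 - q.2) := by simp only [tubeVel]; module
  have e2 : tubePos a ρ x₀ w t p - tubePos a ρ x₀ w t q = ρ • (p.1 - q.1) := by
    simp only [tubePos]; module
  rw [e1, e2, norm_smul, norm_smul, Real.norm_of_nonneg hσ, Real.norm_of_nonneg hρ] at hfor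
  set C := 2 * α * √k * (4 * (‖w‖ + σ) / c) + k
  have hC : 0 ≤ C := by positivity
  have h1 : 0 ≤ σ⁻¹ * (2 * α * √k * σ + C * ρ) := by positivity
  have h2 : 0 ≤ σ / ρ := by positivity
  refine norm_prod_le_iff.2 ⟨?_, ?_⟩
  · rw [Prod.fst_sub, tubeField, tubeField, ← smul_sub, norm_smul, Real.norm_of_nonneg h2]
    calc _ ≤ σ / ρ * ‖p - q‖ := by gcongr
      _ ≤ _ := by gcongr; linarith
  · rw [Prod.snd_sub, tubeField, tubeField, neg_sub_neg, ← smul_sub, norm_smul, norm_sub_rev,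
      Real.norm_of_nonneg (by positivity)]
    calc _ ≤ σ⁻¹ * (2 * α * √k * (σ * ‖p - q‖) + C * (ρ * ‖p - q‖)) := by
          gcongr
          exact hfor.trans (by gcongr)
      _ = (σ⁻¹ * (2 * α * √k * σ + C * ρ)) * ‖p - q‖ := by ring
      _ ≤ _ := by gcongr; linarith

theorem continuousOn_tubeField (hα : 0 ≤ α) (hk : 0 ≤ k) (hc : 0 < c) (hρ : 0 ≤ ρ) (hσ : 0 ≤ σ)
    (htube : ∀ t ∈ Set.Icc a b, c + ρ ≤ (x₀ + (t - a) • w) 0) (hp : ‖p‖ ≤ 1) :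
    ContinuousOn (fun t => tubeField θ α k a ρ σ x₀ w t p) (Set.Icc a b) := by
  have hlip : LipschitzOnWith (2 * α * √k * (4 * (‖w‖ + σ) / c) + k).toNNReal
      (fun x => penaltyForce θ α k x (tubeVel σ w p)) {x | c ≤ x 0} := by
    refine LipschitzOnWith.of_dist_le_mul fun x hx y hy => ?_
    have hfor := norm_penaltyForce_sub_le hα hk hc θ (v := tubeVel σ w p) hx hy
      (norm_tubeVel_le (w := w) hσ hp)
    rw [sub_self, norm_zero, mul_zero, zero_add] at hfor
    rwa [dist_eq_norm, dist_eq_norm, Real.coe_toNNReal _ (by positivity)]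
  have hpos : Continuous fun t => tubePos a ρ x₀ w t p := by unfold tubePos; fun_prop
  have hcont : ContinuousOn
      (fun t => penaltyForce θ α k (tubePos a ρ x₀ w t p) (tubeVel σ w p)) (Set.Icc a b) :=
    hlip.continuousOn.comp hpos.continuousOn fun t ht => le_tubePos hρ (htube t ht) hp
  have h2 : ContinuousOn (fun t => -(σ⁻¹ •
      penaltyForce θ α k (tubePos a ρ x₀ w t p) (tubeVel σ w p))) (Set.Icc a b) := by fun_prop
  unfold tubeField
  exact ContinuousOn.prodMk continuousOn_const h2

theorem isPicardLindelof_tubeField (hab : a ≤ b) (hα : 0 ≤ α) (hk : 0 ≤ k) (hc : 0 < c)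
    (hρ : 0 < ρ) (hσ : 0 < σ) (htube : ∀ t ∈ Set.Icc a b, c + ρ ≤ (x₀ + (t - a) • w) 0)
    (hT : (b - a) * σ ≤ ρ / 2)
    (hF : (b - a) * (2 * α * √k * (‖w‖ + σ) + k * (‖x₀‖ + (b - a) * ‖w‖ + ρ)) ≤ σ / 2) :
    ∃ L K : NNReal, IsPicardLindelof (tubeField θ α k a ρ σ x₀ w) (tmin := a) (tmax := b)
      ⟨a, le_rfl, hab⟩ 0 1 (1 / 2) L K := by
  have hba : 0 ≤ b - a := sub_nonneg.2 hab
  have hL : 0 ≤ max (σ / ρ)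
      (σ⁻¹ * (2 * α * √k * (‖w‖ + σ) + k * (‖x₀‖ + (b - a) * ‖w‖ + ρ))) :=
    le_max_of_le_left (by positivity)
  have hK : 0 ≤ σ / ρ + σ⁻¹ * (2 * α * √k * σ + (2 * α * √k * (4 * (‖w‖ + σ) / c) + k) * ρ) := by
    positivity
  have hball {p : Plane × Plane} (hp : p ∈ Metric.closedBall (0 : Plane × Plane) (1 : NNReal)) :
      ‖p‖ ≤ 1 := by simpa using hp
  refine ⟨NNReal.mk _ hL, NNReal.mk _ hK,
    fun t ht => LipschitzOnWith.of_dist_le_mul fun p hp q hq => ?_,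
    fun p hp => continuousOn_tubeField hα hk hc hρ.le hσ.le htube (hball hp),
    fun t ht p hp => norm_tubeField_le hα hk hρ.le hσ.le ht (hball hp), ?_⟩
  · rw [dist_eq_norm, dist_eq_norm]
    exact norm_tubeField_sub_le hα hk hc hρ.le hσ.le (htube t ht) (hball hp) (hball hq)
  · rw [sub_self, max_eq_left hba, NNReal.coe_mk, max_mul_of_nonneg _ _ hba]
    have : ((1 : NNReal) : ℝ) - ((1 / 2 : NNReal) : ℝ) = 1 / 2 := by push_cast; norm_num
    rw [this]
    refine max_le ?_ ?_
    · rw [div_mul_eq_mul_div, div_le_iff₀ hρ]; linarith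
    · rw [inv_mul_eq_div, div_mul_eq_mul_div, div_le_iff₀ hσ]; linarith

/-- Existence of a motion in a tube around a straight segment at a positive distance of the
cone. -/
theorem exists_isMotionOn_of_tube (hab : a ≤ b) (hα : 0 ≤ α) (hk : 0 ≤ k) (hc : 0 < c)
    (hρ : 0 < ρ) (hσ : 0 < σ) {v₀ : Plane}
    (htube : ∀ t ∈ Set.Icc a b, c + ρ ≤ (x₀ + (t - a) • w) 0) (hT : (b - a) * σ ≤ ρ / 2)
    (hv₀ : ‖v₀ - w‖ ≤ σ / 2)
    (hF : (b - a) * (2 * α * √k * (‖w‖ + σ) + k * (‖x₀‖ + (b - a) * ‖w‖ + ρ)) ≤ σ / 2) :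
    ∃ u v : ℝ → Plane, u a = x₀ ∧ v a = v₀ ∧ IsMotionOn θ α k a (Set.Icc a b) u v := by
  obtain ⟨L, K, hpl⟩ := isPicardLindelof_tubeField (θ := θ) hab hα hk hc hρ hσ htube hT hF
  -- After rescaling, the tube is the unit ball. The initial position is its center and the initial
  -- velocity uses at most half of the radius; the other half absorbs the evolution.
  have hx : ((0 : Plane), σ⁻¹ • (v₀ - w)) ∈
      Metric.closedBall (0 : Plane × Plane) ((1 / 2 : NNReal) : ℝ) := by
    rw [mem_closedBall_zero_iff]
    refine norm_prod_le_iff.2 ⟨by simp, ?_⟩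
    rw [norm_smul, Real.norm_of_nonneg (by positivity), inv_mul_le_iff₀ hσ]
    push_cast
    linarith
  obtain ⟨g, hga, hgd, hfc⟩ := exists_hasDerivWithinAt_continuousOn hpl hx
  set X := fun t => tubePos a ρ x₀ w t (g t) with hX
  set V := fun t => tubeVel σ w (g t) with hV
  have hFc : ContinuousOn (fun t => penaltyForce θ α k (X t) (V t)) (Set.Icc a b) := by
    -- Continuity of the force along the motion is read off the second component of the field, which
    -- is the force up to the factor `-σ⁻¹`.
    have h1 : ContinuousOn (fun t => -σ • (tubeField θ α k a ρ σ x₀ w t (g t)).2) (Set.Icc a b) :=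
      (continuous_snd.comp_continuousOn hfc).const_smul (-σ)
    refine h1.congr fun t ht => ?_
    simp only [tubeField, smul_neg, smul_smul]
    rw [neg_mul, mul_inv_cancel₀ hσ.ne', neg_smul, neg_neg, one_smul]
  have hVd : ∀ t ∈ Set.Icc a b,
      HasDerivWithinAt V (-penaltyForce θ α k (X t) (V t)) (Set.Icc a b) t := fun t ht => by
    have h1 : HasDerivWithinAt (fun t => (g t).2) (tubeField θ α k a ρ σ x₀ w t (g t)).2
      (Set.Icc a b) t := (hgd t ht).snd
    refine ((h1.const_smul σ).const_add w).congr_deriv ?_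
    simp only [tubeField, smul_neg, smul_smul]
    rw [mul_inv_cancel₀ hσ.ne', one_smul]
  have hXd : ∀ t ∈ Set.Icc a b, HasDerivWithinAt X (V t) (Set.Icc a b) t := fun t ht => by
    have h1 : HasDerivWithinAt (fun t => (g t).1) (tubeField θ α k a ρ σ x₀ w t (g t)).1
      (Set.Icc a b) t := (hgd t ht).fst
    have h2 : HasDerivWithinAt (fun t => (t - a) • w) w (Set.Icc a b) t :=
      (((hasDerivAt_id t).sub_const a).smul_const w).hasDerivWithinAt.congr_deriv (by simp)
    refine ((h2.const_add x₀).add (h1.const_smul ρ)).congr_deriv ?_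
    simp only [tubeField, hV, tubeVel, smul_smul]
    rw [mul_div_cancel₀ _ hρ.ne']
  refine ⟨X, V, ?_, ?_, hXd, fun t ht => (hVd t ht).continuousWithinAt, fun t ht => ?_,
    fun t ht => ?_⟩
  · simp [hX, tubePos, hga]
  · simp only [hV, tubeVel, hga, smul_smul]
    rw [mul_inv_cancel₀ hσ.ne', one_smul]; abel
  · refine (hFc.mono ?_).intervalIntegrable
    rw [Set.uIcc_of_le ht.1]
    exact Set.Icc_subset_Icc_right ht.2
  · have hsub : Set.Icc a t ⊆ Set.Icc a b := Set.Icc_subset_Icc_right ht.2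
    have hi : IntervalIntegrable (fun t => -penaltyForce θ α k (X t) (V t)) volume a t := by
      refine (hFc.neg.mono ?_).intervalIntegrable
      rwa [Set.uIcc_of_le ht.1]
    have h1 := intervalIntegral.integral_eq_sub_of_hasDerivAt_of_le ht.1
      (fun s hs => ((hVd s (hsub hs)).mono hsub).continuousWithinAt)
      (fun s hs => (hVd s (hsub ⟨hs.1.le, hs.2.le⟩)).hasDerivAt
        (Icc_mem_nhds hs.1 (hs.2.trans_le ht.2))) hi
    rw [intervalIntegral.integral_neg] at h1
    rw [← neg_neg (∫ s in a..t, penaltyForce θ α k (X s) (V s)), h1]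
    abel

end Tube

end Construction

/-! ### Decay rates, and coordinates of the projections -/

/-- The slow decay rate of the overdamped normal motion. -/
noncomputable def slowRate (α k : ℝ) : ℝ := √k * (α - √(α ^ 2 - 1))

/-- The fast decay rate of the overdamped normal motion. -/
noncomputable def fastRate (α k : ℝ) : ℝ := √k * (α + √(α ^ 2 - 1))

section Rates

variable {α k : ℝ}

theorem sqrt_sq_sub_one_pos (hα : 1 < α) : 0 < √(α ^ 2 - 1) := Real.sqrt_pos.2 (by nlinarith)

theorem sqrt_sq_sub_one_lt (hα : 1 < α) : √(α ^ 2 - 1) < α :=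
  (Real.sqrt_lt' (by linarith)).2 (by linarith)

theorem slowRate_pos (hα : 1 < α) (hk : 0 < k) : 0 < slowRate α k :=
  mul_pos (Real.sqrt_pos.2 hk) (sub_pos.2 (sqrt_sq_sub_one_lt hα))

theorem fastRate_sub_slowRate (α k : ℝ) :
    fastRate α k - slowRate α k = 2 * √(α ^ 2 - 1) * √k := by
  unfold fastRate slowRate; ring

theorem slowRate_lt_fastRate (hα : 1 < α) (hk : 0 < k) : slowRate α k < fastRate α k := by
  have := sqrt_sq_sub_one_pos hα
  have := Real.sqrt_pos.2 hk
  rw [← sub_pos, fastRate_sub_slowRate]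
  positivity

theorem slowRate_add_fastRate (α k : ℝ) : slowRate α k + fastRate α k = 2 * α * √k := by
  unfold fastRate slowRate; ring

theorem slowRate_mul_fastRate (hα : 1 < α) (hk : 0 ≤ k) : slowRate α k * fastRate α k = k := by
  have h1 := Real.sq_sqrt (show 0 ≤ α ^ 2 - 1 by nlinarith)
  have h2 := Real.sq_sqrt hk
  unfold fastRate slowRate
  linear_combination (1 : ℝ) * h2 - √k ^ 2 * h1

end Rates

theorem inner_pair (x : Plane) (a b : ℝ) : inner ℝ x !₂[a, b] = x 0 * a + x 1 * b := by
  simp [PiLp.inner_apply]; ring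

theorem proj₁_apply (x : Plane) : proj₁ x = !₂[0, x 1] := by
  rw [proj₁]
  refine Submodule.eq_starProjection_of_mem_of_inner_eq_zero (K := line₁) ?_ fun y hy => ?_
  · change (!₂[(0 : ℝ), x 1] : Plane) 0 = 0
    simp
  · have hy : y 0 = 0 := hy
    simp [PiLp.inner_apply, hy]

theorem proj₂_apply (θ : ℝ) (x : Plane) :
    proj₂ θ x = (inner ℝ x !₂[-Real.sin θ, Real.cos θ]) • !₂[-Real.sin θ, Real.cos θ] := by
  have h := Real.sin_sq_add_cos_sq θ
  rw [proj₂]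
  refine Submodule.eq_starProjection_of_mem_of_inner_eq_zero (K := line₂ θ) ?_ fun y hy => ?_
  · change (_ : Plane) 0 * Real.cos θ + (_ : Plane) 1 * Real.sin θ = 0
    simp; ring
  · have hy : y 0 * Real.cos θ + y 1 * Real.sin θ = 0 := hy
    simp [PiLp.inner_apply]
    linear_combination (-x 0 * y 0 - x 1 * y 1) * h +
      (x 0 * Real.cos θ + x 1 * Real.sin θ) * hy

/-! ### Crossing from the first side to the second -/

/-- The time, in units of the distance to the first side, that a point moving along the first side
with velocity `p` takes to face the second side. -/
noncomputable def crossingTime (θ p : ℝ) : ℝ := (Real.tan θ + 1) / p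

/-- A bound for the deviation of the velocity from `(0, p)` in the passage from the first side to
the second one, when `ε` is the initial distance to the first side and `ω` its initial rate of
change. -/
noncomputable def crossingError (θ α k p ε ω σ : ℝ) : ℝ :=
  |ω| + crossingTime θ p * ε *
    (2 * α * √k * (p + σ) + k * (2 * ε + crossingTime θ p * ε * (p + σ)))

/-- `σ` is a deviation from the velocity `(0, p)` that is harmless in the passage from the
first side to the second one. -/
structure IsHarmless (θ p σ : ℝ) : Prop where
  pos : 0 < σ
  le_quarter : crossingTime θ p * σ ≤ 1 / 4
  lt_cos : crossingTime θ p * σ < Real.cos θ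
  lt_mul_sin : σ < p * Real.sin θ
  lt_mul_cos : σ < p * Real.cos θ

section Crossing

variable {θ α k a p ε ω σ : ℝ} {u v : ℝ → Plane}

theorem crossingTime_pos (hc : 0 < Real.cos θ) (hs : 0 < Real.sin θ) (hp : 0 < p) :
    0 < crossingTime θ p := by
  unfold crossingTime
  rw [Real.tan_eq_sin_div_cos]
  positivity

theorem eventually_isHarmless (hc : 0 < Real.cos θ) (hs : 0 < Real.sin θ) (hp : 0 < p) :
    ∀ᶠ σ in 𝓝[>] 0, IsHarmless θ p σ := by
  have h1 : Tendsto (fun σ : ℝ => crossingTime θ p * σ) (𝓝[>] 0) (𝓝 0) := by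
    have : Tendsto (fun σ : ℝ => crossingTime θ p * σ) (𝓝 0) (𝓝 (crossingTime θ p * 0)) :=
      (continuous_const.mul continuous_id).tendsto 0
    rw [mul_zero] at this
    exact this.mono_left nhdsWithin_le_nhds
  have h2 : Tendsto (fun σ : ℝ => σ) (𝓝[>] 0) (𝓝 0) := nhdsWithin_le_nhds
  filter_upwards [self_mem_nhdsWithin, h1.eventually_le_const (show (0 : ℝ) < 1 / 4 by norm_num),
    h1.eventually_lt_const hc, h2.eventually_lt_const (mul_pos hp hs),
    h2.eventually_lt_const (mul_pos hp hc)] with σ a b c d e using ⟨a, b, c, d, e⟩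

theorem norm_pair_zero_left (hp : 0 ≤ p) : ‖(!₂[0, p] : Plane)‖ = p := by
  simp [EuclideanSpace.norm_eq, Real.sqrt_sq hp]

theorem norm_pair_zero_right (p : ℝ) : ‖(!₂[p, 0] : Plane)‖ = |p| := by
  simp [EuclideanSpace.norm_eq, Real.sqrt_sq_eq_abs]

theorem pair_sub_pair (ω p : ℝ) : (!₂[ω, p] : Plane) - !₂[0, p] = !₂[ω, 0] := by
  ext i; fin_cases i <;> simp

theorem IsMotionOn.crossing (hα : 0 ≤ α) (hk : 0 ≤ k) (hc : 0 < Real.cos θ) (hs : 0 < Real.sin θ)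
    (hp : 0 < p) (hε : 0 < ε) (hσ : 0 < σ) (hE : crossingError θ α k p ε ω σ < σ)
    (h : IsMotionOn θ α k a (Set.Icc a (a + crossingTime θ p * ε)) u v)
    (hu : u a = !₂[ε, 0]) (hv : v a = !₂[ω, p]) :
    ∀ t ∈ Set.Icc a (a + crossingTime θ p * ε), ‖v t - !₂[0, p]‖ < σ ∧
      ‖u t - (!₂[ε, 0] + (t - a) • !₂[0, p])‖ ≤ σ * (t - a) := by
  have hℓ := crossingTime_pos hc hs hp
  have hv' : ∀ t ∈ Set.Icc a (a + crossingTime θ p * ε), ‖v t - !₂[0, p]‖ < σ := by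
    refine h.norm_vel_sub_lt (by nlinarith [mul_pos hℓ hε]) hα hk hσ.le (lt_of_le_of_lt ?_ hE)
    unfold crossingError
    rw [hv, hu, pair_sub_pair, norm_pair_zero_right, norm_pair_zero_right,
      norm_pair_zero_left hp.le, abs_of_pos hε, add_sub_cancel_left]
    gcongr
    linarith
  refine fun t ht => ⟨hv' t ht, ?_⟩
  have := h.norm_sub_affine_le (w := !₂[0, p]) (σ := σ)
    (fun s hs => (hv' s (Set.Ico_subset_Icc_self hs)).le) t ht
  rwa [hu] at this

theorem abs_inner_le_of_norm_eq_one {x e : Plane} (he : ‖e‖ = 1) : |inner ℝ x e| ≤ ‖x‖ := by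
  simpa [he] using abs_real_inner_le_norm x e

theorem norm_second_normal (θ : ℝ) : ‖(!₂[Real.cos θ, Real.sin θ] : Plane)‖ = 1 := by
  simp [EuclideanSpace.norm_eq]

theorem norm_second_tangent (θ : ℝ) : ‖(!₂[-Real.sin θ, Real.cos θ] : Plane)‖ = 1 := by
  simp [EuclideanSpace.norm_eq]

/-- The state at the end of the passage from the first side to the second one. -/
theorem inner_pos_after_crossing (hc : 0 < Real.cos θ) (hs : 0 < Real.sin θ) (hp : 0 < p)
    (hε : 0 < ε) (hσ : IsHarmless θ p σ) {x w : Plane} (hw : ‖w - !₂[0, p]‖ ≤ σ)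
    (hx : ‖x - (!₂[ε, 0] + (crossingTime θ p * ε) • !₂[0, p])‖ ≤ σ * (crossingTime θ p * ε)) :
    0 < inner ℝ x !₂[Real.cos θ, Real.sin θ] ∧ 0 < inner ℝ x !₂[-Real.sin θ, Real.cos θ] ∧
    0 < inner ℝ w !₂[Real.cos θ, Real.sin θ] ∧ 0 < inner ℝ w !₂[-Real.sin θ, Real.cos θ] := by
  have hx1 := (abs_le.1 ((abs_inner_le_of_norm_eq_one (norm_second_normal θ)).trans hx)).1
  have hx2 := (abs_le.1 ((abs_inner_le_of_norm_eq_one (norm_second_tangent θ)).trans hx)).1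
  have hw1 := (abs_le.1 ((abs_inner_le_of_norm_eq_one (norm_second_normal θ)).trans hw)).1
  have hw2 := (abs_le.1 ((abs_inner_le_of_norm_eq_one (norm_second_tangent θ)).trans hw)).1
  rw [inner_sub_left] at hx1 hx2 hw1 hw2
  have e1 : inner ℝ (!₂[ε, 0] + (crossingTime θ p * ε) • !₂[0, p] : Plane)
      !₂[Real.cos θ, Real.sin θ] = ε * (Real.cos θ + crossingTime θ p * p * Real.sin θ) := by
    rw [inner_pair]; simp; ring
  have e2 : inner ℝ (!₂[ε, 0] + (crossingTime θ p * ε) • !₂[0, p] : Plane)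
      !₂[-Real.sin θ, Real.cos θ] = ε * Real.cos θ := by
    -- The term `tan θ / p` brings the point to the normal line of the second side through the apex;
    -- the extra `1 / p` carries it `ε cos θ` further, a margin that the deviation `σ` cannot use
    -- up.
    have : crossingTime θ p * p * Real.cos θ = Real.sin θ + Real.cos θ := by
      unfold crossingTime
      rw [Real.tan_eq_sin_div_cos]
      field_simp
    rw [inner_pair]; simp
    linear_combination ε * this
  have e3 : inner ℝ (!₂[0, p] : Plane) !₂[Real.cos θ, Real.sin θ] = p * Real.sin θ := by
    rw [inner_pair]; simp
  have e4 : inner ℝ (!₂[0, p] : Plane) !₂[-Real.sin θ, Real.cos θ] = p * Real.cos θ := by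
    rw [inner_pair]; simp
  rw [e1] at hx1
  rw [e2] at hx2
  rw [e3] at hw1
  rw [e4] at hw2
  have hℓ := crossingTime_pos hc hs hp
  have h1 := mul_lt_mul_of_pos_left hσ.lt_cos hε
  have h2 : 0 < ε * (crossingTime θ p * p * Real.sin θ) := by positivity
  refine ⟨by nlinarith, by nlinarith, by linarith [hσ.lt_mul_sin], by linarith [hσ.lt_mul_cos]⟩

end Crossing

/-! ### Motion along the first side, and existence of solutions -/

section Sliding

variable {θ α k x₂ p₁ p₂ : ℝ} {u v : ℝ → Plane}

/-- The motion along the first side, up to the time when it reaches the apex. -/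
theorem IsMotionOn.eq_before_crossing (hs : 0 < Real.sin θ) (hα : 1 < α) (hk : 0 < k)
    (hx₂ : x₂ < 0) (hp₁ : 0 < p₁) (hp₂ : 0 < p₂)
    (h : IsMotionOn θ α k 0 (Set.Icc 0 (-x₂ / p₂)) u v)
    (hu : u 0 = !₂[0, x₂]) (hv : v 0 = !₂[p₁, p₂]) :
    ∀ t ∈ Set.Icc 0 (-x₂ / p₂),
      u t = !₂[dampedPos (slowRate α k) (fastRate α k) 0 p₁ t, x₂ + t * p₂] ∧
      v t = !₂[dampedVel (slowRate α k) (fastRate α k) 0 p₁ t, p₂] := by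
  intro t ht
  have hpos : 0 < -x₂ / p₂ := div_pos (neg_pos.2 hx₂) hp₂
  have key := h.eq_on_side hpos (isSide_first hs) (slowRate_pos hα hk).le
    (slowRate_lt_fastRate hα hk) (slowRate_add_fastRate α k) (slowRate_mul_fastRate hα hk.le)
    (by rw [hu, inner_pair]; simp) (by rw [hv, inner_pair]; simpa using hp₁)
    (fun t ht => by
      rw [hu, hv, inner_pair, inner_pair]
      have := (lt_div_iff₀ hp₂).1 ht.2
      simp
      linarith) t ht
  simp only [hu, hv, inner_pair] at key
  obtain ⟨e1, e2, e3, e4⟩ := key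
  simp at e1 e2 e3 e4
  constructor
  · ext i; fin_cases i
    · simpa using e1
    · simp; linarith
  · ext i; fin_cases i
    · simpa using e2
    · simpa using e4

/-- The distance to the first side when the motion reaches the apex. -/
noncomputable def gap (α k p₁ t₀ : ℝ) : ℝ := dampedPos (slowRate α k) (fastRate α k) 0 p₁ t₀

/-- The rate of change of the distance to the first side when the motion reaches the apex. -/
noncomputable def gapVel (α k p₁ t₀ : ℝ) : ℝ := dampedVel (slowRate α k) (fastRate α k) 0 p₁ t₀

/-- Explicit slide, Picard-Lindelöf crossing, explicit slide. The bound `σ / 2` in `hE`, rather than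
`σ`, pays separately for the initial deviation and for the effect of the force in the tube. -/
theorem exists_isPenaltySolution {σ : ℝ} (hc : 0 < Real.cos θ) (hs : 0 < Real.sin θ) (hα : 1 < α)
    (hk : 0 < k) (hx₂ : x₂ < 0) (hp₁ : 0 < p₁) (hp₂ : 0 < p₂) (hσ : IsHarmless θ p₂ σ)
    (hE : crossingError θ α k p₂ (gap α k p₁ (-x₂ / p₂)) (gapVel α k p₁ (-x₂ / p₂)) σ < σ / 2) :
    ∃ w : ℝ → Plane, IsPenaltySolution θ α k !₂[0, x₂] !₂[p₁, p₂] w := by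
  set t₀ := -x₂ / p₂ with ht₀
  set ε := gap α k p₁ t₀ with hε
  set ω := gapVel α k p₁ t₀ with hω
  set ℓ := crossingTime θ p₂ with hℓ
  have ht₀p : 0 < t₀ := div_pos (neg_pos.2 hx₂) hp₂
  have hl := slowRate_pos hα hk
  have hlm := slowRate_lt_fastRate hα hk
  have hadd := slowRate_add_fastRate α k
  have hmul := slowRate_mul_fastRate hα hk.le
  have hεp : 0 < ε := dampedPos_pos hl.le hlm le_rfl hp₁ ht₀p
  have hℓp : 0 < ℓ := crossingTime_pos hc hs hp₂
  have hσp := hσ.pos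
  -- The tangent of the first side points downwards, away from the apex, hence the signs of `z` and
  -- `ζ`.
  have m1 : IsMotionOn θ α k 0 (Set.Icc 0 t₀) _ _ :=
    (isSide_first hs).isMotionOn (a := 0) (y := 0) (w := p₁) (z := -x₂) (ζ := -p₂) hl.le hlm hadd
      hmul le_rfl hp₁ fun t ht => ⟨ht.1, fun s hs' => by
        have := (le_div_iff₀ hp₂).1 (hs'.2.trans ht.2)
        linarith⟩
  have hE' := hE
  unfold crossingError at hE'
  have hba : t₀ + ℓ * ε - t₀ = ℓ * ε := by ring
  have hpos : 0 ≤ ℓ * ε * (2 * α * √k * (p₂ + σ) + k * (2 * ε + ℓ * ε * (p₂ + σ))) := by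
    positivity
  -- The straight reference motion keeps first coordinate `ε`, which is split evenly between the
  -- radius of the tube and its distance to the cone.
  obtain ⟨u₂, v₂, hu₂, hv₂, m2⟩ := exists_isMotionOn_of_tube (θ := θ) (α := α) (k := k) (a := t₀)
    (b := t₀ + ℓ * ε) (c := ε / 2) (ρ := ε / 2) (σ := σ) (x₀ := !₂[ε, 0]) (w := !₂[0, p₂])
    (v₀ := !₂[ω, p₂]) (by nlinarith) (by linarith) hk.le (by linarith) (by linarith) hσp
    (fun t _ => by simp) (by rw [hba]; nlinarith [hσ.le_quarter])
    (by rw [pair_sub_pair, norm_pair_zero_right]; linarith)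
    (by
      rw [hba, norm_pair_zero_left hp₂.le, norm_pair_zero_right, abs_of_pos hεp]
      -- The `2 * ε` in `crossingError` leaves room for the radius `ε / 2` of the tube.
      have : ℓ * ε * (2 * α * √k * (p₂ + σ) + k * (ε + ℓ * ε * p₂ + ε / 2)) ≤
          ℓ * ε * (2 * α * √k * (p₂ + σ) + k * (2 * ε + ℓ * ε * (p₂ + σ))) := by
        have : ε + ℓ * ε * p₂ + ε / 2 ≤ 2 * ε + ℓ * ε * (p₂ + σ) := by
          nlinarith [mul_pos (mul_pos hℓp hεp) hσp]
        gcongr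
      linarith [abs_nonneg ω])
  have hcross := m2.crossing (by linarith) hk.le hc hs hp₂ hεp hσp (by linarith) hu₂ hv₂
    (t₀ + ℓ * ε) ⟨by nlinarith, le_rfl⟩
  rw [hba] at hcross
  obtain ⟨i1, i2, i3, i4⟩ := inner_pos_after_crossing hc hs hp₂ hεp hσ hcross.1.le hcross.2
  set t₁ := t₀ + ℓ * ε with ht₁
  have m3 : IsMotionOn θ α k t₁ (Set.Ici t₁) _ _ :=
    (isSide_second hs).isMotionOn (a := t₁) hl.le hlm hadd hmul i1.le i3
      (z := inner ℝ (u₂ t₁) !₂[-Real.sin θ, Real.cos θ])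
      (ζ := inner ℝ (v₂ t₁) !₂[-Real.sin θ, Real.cos θ])
      fun t ht => ⟨ht, fun s hs' => by
        have := mul_pos (sub_pos.2 hs'.1) i4
        linarith⟩
  have m23 := m2.glue (by nlinarith) m3
    (by
      simp only [sub_self, dampedPos_zero, zero_mul, add_zero]
      exact (isSide_second hs).decomp _)
    (by
      simp only [sub_self, dampedVel_zero]
      exact (isSide_second hs).decomp _)
  have hle : t₀ ≤ t₁ := by nlinarith
  have m := m1.glue ht₀p.le m23
    (by
      simp only [if_pos hle, hu₂, sub_zero]
      have : t₀ * p₂ = -x₂ := div_mul_cancel₀ _ hp₂.ne'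
      ext i; fin_cases i
      · simp [hε, gap]
      · simp; linarith)
    (by
      simp only [if_pos hle, hv₂, sub_zero]
      ext i; fin_cases i
      · simp [hω, gapVel]
      · simp)
  refine ⟨_, ?_, _, m.continuousOn_vel, fun t ht => m.hasDeriv t ht, fun t ht =>
    ⟨m.integrable t ht, (m.vel_eq t ht).trans ?_⟩⟩
  · simp only [if_pos ht₀p.le, sub_zero, dampedPos_zero]
    ext i; fin_cases i <;> simp
  · congr 1
    simp only [if_pos ht₀p.le, sub_zero, dampedVel_zero]
    ext i; fin_cases i <;> simp

end Sliding

/-! ### Smallness of the crossing as the stiffness grows -/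

section Asymptotics

variable {α p₁ t₀ : ℝ}

theorem gap_pos {k : ℝ} (hα : 1 < α) (hk : 0 < k) (hp₁ : 0 < p₁) (ht₀ : 0 < t₀) :
    0 < gap α k p₁ t₀ :=
  dampedPos_pos (slowRate_pos hα hk).le (slowRate_lt_fastRate hα hk) le_rfl hp₁ ht₀

theorem tendsto_exp_neg_mul_sqrt {c : ℝ} (hc : 0 < c) :
    Tendsto (fun k : ℝ => Real.exp (-(c * √k))) atTop (𝓝 0) :=
  Real.tendsto_exp_neg_atTop_nhds_zero.comp (Real.tendsto_sqrt_atTop.const_mul_atTop hc)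

/-- The gap is at most a constant times `exp (-c √k) / √k` with `c > 0`. Convergence of the gap
alone would not do, since the force in the crossing grows with `k`. -/
theorem tendsto_sqrt_mul_gap (hα : 1 < α) (hp₁ : 0 < p₁) (ht₀ : 0 < t₀) :
    Tendsto (fun k : ℝ => √k * gap α k p₁ t₀) atTop (𝓝 0) := by
  have hβ := sqrt_sq_sub_one_pos hα
  have hc : 0 < (α - √(α ^ 2 - 1)) * t₀ := mul_pos (sub_pos.2 (sqrt_sq_sub_one_lt hα)) ht₀
  have hlim := (tendsto_exp_neg_mul_sqrt hc).const_mul (p₁ / (2 * √(α ^ 2 - 1)))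
  rw [mul_zero] at hlim
  refine squeeze_zero' ?_ ?_ hlim
  · filter_upwards [eventually_gt_atTop 0] with k hk
    have := gap_pos hα hk hp₁ ht₀
    positivity
  · filter_upwards [eventually_gt_atTop 0] with k hk
    have hsk := Real.sqrt_pos.2 hk
    have h1 := dampedPos_le (t := t₀) (slowRate_pos hα hk).le (slowRate_lt_fastRate hα hk)
      (le_refl (0 : ℝ)) hp₁.le
    rw [fastRate_sub_slowRate, mul_zero, add_zero, zero_add] at h1
    calc √k * gap α k p₁ t₀
        ≤ √k * (p₁ / (2 * √(α ^ 2 - 1) * √k) * Real.exp (-slowRate α k * t₀)) := by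
          unfold gap; gcongr
      _ = p₁ / (2 * √(α ^ 2 - 1)) * Real.exp (-slowRate α k * t₀) := by field_simp
      _ = _ := by
          congr 2
          unfold slowRate; ring

theorem tendsto_gap (hα : 1 < α) (hp₁ : 0 < p₁) (ht₀ : 0 < t₀) :
    Tendsto (fun k : ℝ => gap α k p₁ t₀) atTop (𝓝 0) := by
  refine squeeze_zero' ?_ ?_ (tendsto_sqrt_mul_gap hα hp₁ ht₀)
  · filter_upwards [eventually_gt_atTop 0] with k hk using (gap_pos hα hk hp₁ ht₀).le
  · filter_upwards [eventually_ge_atTop 1] with k hk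
    exact le_mul_of_one_le_left (gap_pos hα (by linarith) hp₁ ht₀).le (Real.one_le_sqrt.2 hk)

theorem tendsto_gapVel (hα : 1 < α) (hp₁ : 0 < p₁) (ht₀ : 0 < t₀) :
    Tendsto (fun k : ℝ => gapVel α k p₁ t₀) atTop (𝓝 0) := by
  have hc : 0 < (α + √(α ^ 2 - 1)) * t₀ :=
    mul_pos (by linarith [sqrt_sq_sub_one_pos hα]) ht₀
  have hlim := ((tendsto_exp_neg_mul_sqrt hc).const_mul p₁).sub
    ((tendsto_sqrt_mul_gap hα hp₁ ht₀).const_mul (α - √(α ^ 2 - 1)))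
  simp only [mul_zero, sub_zero] at hlim
  refine hlim.congr fun k => ?_
  unfold gapVel dampedVel
  rw [mul_zero, add_zero]
  have e1 : -((α + √(α ^ 2 - 1)) * t₀ * √k) = -fastRate α k * t₀ := by unfold fastRate; ring
  rw [e1, gap, slowRate]
  ring

/-- Apart from `|ω|`, the error is a polynomial without constant term in `√k ε`. -/
theorem tendsto_crossingError (θ p σ : ℝ) (hα : 1 < α) (hp₁ : 0 < p₁) (ht₀ : 0 < t₀) :
    Tendsto (fun k : ℝ => crossingError θ α k p (gap α k p₁ t₀) (gapVel α k p₁ t₀) σ)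
      atTop (𝓝 0) := by
  have h := tendsto_sqrt_mul_gap hα hp₁ ht₀
  have hlim := ((tendsto_gapVel hα hp₁ ht₀).abs.add
    (h.const_mul (crossingTime θ p * (2 * α * (p + σ))))).add
      ((h.mul h).const_mul (crossingTime θ p * (2 + crossingTime θ p * (p + σ))))
  simp only [mul_zero, abs_zero, add_zero] at hlim
  refine hlim.congr' ?_
  filter_upwards [eventually_ge_atTop 0] with k hk
  have := Real.sq_sqrt hk
  unfold crossingError
  linear_combination (crossingTime θ p * gap α k p₁ t₀ *
    (2 * gap α k p₁ t₀ + crossingTime θ p * gap α k p₁ t₀ * (p + σ))) * this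

end Asymptotics

/-! ### Distance to the limit motion -/

/-- A bound for the distance to the limit motion at times at most `B`, when the velocity deviates by
at most `σ` from `(0, p₂)` in the passage from the first side to the second one. -/
noncomputable def limitError (θ α k x₂ p₁ p₂ σ B : ℝ) : ℝ :=
  -- The summands are the normal displacement created by the velocities on the two sides, the effect
  -- of the position at the end of the crossing on both coordinates, the path of the limit motion
  -- during the crossing, and the drift due to the error on the tangential speed.
  (p₁ + p₂ + σ) / (2 * √(α ^ 2 - 1) * √k) +
    (2 + (α - √(α ^ 2 - 1)) / (2 * √(α ^ 2 - 1))) *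
      (gap α k p₁ (-x₂ / p₂) * (1 + crossingTime θ p₂ * (p₂ + σ))) +
    crossingTime θ p₂ * gap α k p₁ (-x₂ / p₂) * p₂ + B * σ

/-- For fixed `σ` only the drift `B * σ` persists; it is removed at the end by the choice of `σ`. -/
theorem tendsto_limitError {θ α x₂ p₁ p₂ σ B : ℝ} (hα : 1 < α) (hx₂ : x₂ < 0) (hp₁ : 0 < p₁)
    (hp₂ : 0 < p₂) :
    Tendsto (fun k : ℝ => limitError θ α k x₂ p₁ p₂ σ B) atTop (𝓝 (B * σ)) := by
  have hβ := sqrt_sq_sub_one_pos hα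
  have hg := tendsto_gap hα hp₁ (div_pos (neg_pos.2 hx₂) hp₂)
  have h1 : Tendsto (fun k : ℝ => (p₁ + p₂ + σ) / (2 * √(α ^ 2 - 1) * √k)) atTop (𝓝 0) :=
    (Real.tendsto_sqrt_atTop.const_mul_atTop (by positivity)).const_div_atTop _
  have h := ((h1.add ((hg.mul_const (1 + crossingTime θ p₂ * (p₂ + σ))).const_mul
    (2 + (α - √(α ^ 2 - 1)) / (2 * √(α ^ 2 - 1))))).add
      ((hg.const_mul (crossingTime θ p₂)).mul_const p₂)).add_const (B * σ)
  simpa [limitError] using h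

section Limit

variable {θ α k x₂ p₁ p₂ σ B : ℝ} {u v : ℝ → Plane}

theorem limitMotion_of_le {t₀ t : ℝ} (ht : t ≤ t₀) :
    limitMotion θ t₀ !₂[0, x₂] !₂[p₁, p₂] t = !₂[0, x₂ + t * p₂] := by
  rw [limitMotion, if_pos ht, proj₁_apply]
  ext i; fin_cases i <;> simp

theorem limitMotion_of_lt {t₀ t : ℝ} (ht : t₀ < t) :
    limitMotion θ t₀ !₂[0, x₂] !₂[p₁, p₂] t
      = ((t - t₀) * (p₂ * Real.cos θ)) • !₂[-Real.sin θ, Real.cos θ] := by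
  rw [limitMotion, if_neg (not_le.2 ht), proj₁_apply, proj₂_apply, inner_pair, smul_smul]
  simp

theorem norm_limitMotion_le {t₀ t : ℝ} (hp₂ : 0 ≤ p₂) (ht : t₀ < t) :
    ‖limitMotion θ t₀ !₂[0, x₂] !₂[p₁, p₂] t‖ ≤ (t - t₀) * p₂ := by
  have h0 : 0 < t - t₀ := sub_pos.2 ht
  rw [limitMotion_of_lt ht, norm_smul, norm_second_tangent, mul_one, Real.norm_eq_abs, abs_mul,
    abs_mul, abs_of_pos h0, abs_of_nonneg hp₂]
  gcongr
  exact mul_le_of_le_one_right hp₂ (Real.abs_cos_le_one θ)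

theorem IsMotionOn.norm_le_of_crossing {a p ε ω : ℝ} (hα : 0 ≤ α) (hk : 0 ≤ k)
    (hc : 0 < Real.cos θ) (hs : 0 < Real.sin θ) (hp : 0 < p) (hε : 0 < ε) (hσ : 0 < σ)
    (hE : crossingError θ α k p ε ω σ < σ)
    (h : IsMotionOn θ α k a (Set.Icc a (a + crossingTime θ p * ε)) u v)
    (hu : u a = !₂[ε, 0]) (hv : v a = !₂[ω, p]) :
    ∀ t ∈ Set.Icc a (a + crossingTime θ p * ε),
      ‖u t‖ ≤ ε * (1 + crossingTime θ p * (p + σ)) := by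
  intro t ht
  have h1 := (h.crossing hα hk hc hs hp hε hσ hE hu hv t ht).2
  have h0 : 0 ≤ t - a := sub_nonneg.2 ht.1
  have h0' : t - a ≤ crossingTime θ p * ε := by linarith [ht.2]
  calc ‖u t‖ = ‖!₂[ε, 0] + (t - a) • !₂[0, p] + (u t - (!₂[ε, 0] + (t - a) • !₂[0, p]))‖ := by
        congr 1; abel
    _ ≤ ‖(!₂[ε, 0] : Plane)‖ + ‖(t - a) • (!₂[0, p] : Plane)‖ + σ * (t - a) :=
        norm_add₃_le.trans (by gcongr)
    _ = ε + (t - a) * (p + σ) := by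
        rw [norm_smul, norm_pair_zero_left hp.le, norm_pair_zero_right, abs_of_pos hε,
          Real.norm_of_nonneg h0]
        ring
    _ ≤ ε + (crossingTime θ p * ε) * (p + σ) := by gcongr
    _ = _ := by ring

/-- The initial position contributes through `slowRate α k * y`, but the factor `√k` cancels against
the difference of the rates, so its effect is bounded uniformly in `k`. -/
theorem dampedPos_rates_le {y w t A W : ℝ} (hα : 1 < α) (hk : 0 < k) (hy : 0 ≤ y) (hw : 0 ≤ w)
    (ht : 0 ≤ t) (hyA : y ≤ A) (hwW : w ≤ W) :
    dampedPos (slowRate α k) (fastRate α k) y w t ≤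
      A + W / (2 * √(α ^ 2 - 1) * √k) + (α - √(α ^ 2 - 1)) / (2 * √(α ^ 2 - 1)) * A := by
  have hβ := sqrt_sq_sub_one_pos hα
  have hβα := sub_pos.2 (sqrt_sq_sub_one_lt hα)
  have hsk := Real.sqrt_pos.2 hk
  have hl := slowRate_pos hα hk
  have h1 := dampedPos_le (t := t) hl.le (slowRate_lt_fastRate hα hk) hy hw
  rw [fastRate_sub_slowRate] at h1
  have h2 : Real.exp (-slowRate α k * t) ≤ 1 :=
    Real.exp_le_one_iff.2 (by nlinarith [mul_nonneg hl.le ht])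
  have h3 : 0 ≤ y + (w + slowRate α k * y) / (2 * √(α ^ 2 - 1) * √k) := by positivity
  calc _ ≤ y + (w + slowRate α k * y) / (2 * √(α ^ 2 - 1) * √k) :=
        h1.trans (mul_le_of_le_one_right h3 h2)
    _ = y + w / (2 * √(α ^ 2 - 1) * √k) + (α - √(α ^ 2 - 1)) / (2 * √(α ^ 2 - 1)) * y := by
        unfold slowRate; field_simp; ring
    _ ≤ _ := by gcongr

/-- The motion along the second side stays close to a uniform motion that started from the apex the
time `δ` earlier. -/
theorem IsMotionOn.norm_sub_le_after_crossing {a b p A δ : ℝ} (hc : 0 < Real.cos θ)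
    (hs : 0 < Real.sin θ) (hα : 1 < α) (hk : 0 < k) (hp : 0 < p) (hδ : 0 < δ) (hab : a < b)
    (h : IsMotionOn θ α k a (Set.Icc a b) u v)
    (hu : ‖u a‖ ≤ A) (hv : ‖v a - !₂[0, p]‖ ≤ σ)
    (hun : 0 < inner ℝ (u a) !₂[Real.cos θ, Real.sin θ])
    (huτ : 0 < inner ℝ (u a) !₂[-Real.sin θ, Real.cos θ])
    (hvn : 0 < inner ℝ (v a) !₂[Real.cos θ, Real.sin θ])
    (hvτ : 0 < inner ℝ (v a) !₂[-Real.sin θ, Real.cos θ]) :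
    ‖u b - ((b - a + δ) * (p * Real.cos θ)) • !₂[-Real.sin θ, Real.cos θ]‖ ≤
      (A + (p + σ) / (2 * √(α ^ 2 - 1) * √k) + (α - √(α ^ 2 - 1)) / (2 * √(α ^ 2 - 1)) * A) +
      (A + (b - a) * σ + δ * p) := by
  have hl := slowRate_pos hα hk
  have hlm := slowRate_lt_fastRate hα hk
  obtain ⟨e1, -, e3, -⟩ := h.eq_on_side hab (isSide_second hs) hl.le hlm
    (slowRate_add_fastRate α k) (slowRate_mul_fastRate hα hk.le) hun.le hvn
    (fun s hs' => by nlinarith [mul_nonneg (sub_nonneg.2 hs'.1) hvτ.le]) b ⟨hab.le, le_rfl⟩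
  have hy := (le_abs_self _).trans
    ((abs_inner_le_of_norm_eq_one (x := u a) (norm_second_normal θ)).trans hu)
  have hz := (le_abs_self _).trans
    ((abs_inner_le_of_norm_eq_one (x := u a) (norm_second_tangent θ)).trans hu)
  have hw : inner ℝ (v a) !₂[Real.cos θ, Real.sin θ] ≤ p + σ := by
    refine (le_abs_self _).trans ((abs_inner_le_of_norm_eq_one (norm_second_normal θ)).trans ?_)
    calc ‖v a‖ = ‖!₂[0, p] + (v a - !₂[0, p])‖ := by congr 1; abel
      _ ≤ p + σ := (norm_add_le _ _).trans (by rw [norm_pair_zero_left hp.le]; gcongr)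
  have hζ : |inner ℝ (v a) !₂[-Real.sin θ, Real.cos θ] - p * Real.cos θ| ≤ σ := by
    have := (abs_inner_le_of_norm_eq_one (x := v a - !₂[0, p]) (norm_second_tangent θ)).trans hv
    rw [inner_sub_left, inner_pair !₂[0, p]] at this
    simpa using this
  have hdec := (isSide_second hs).decomp (u b)
  rw [e1, e3] at hdec
  have hY0 := (dampedPos_pos hl.le hlm hun.le hvn (sub_pos.2 hab)).le
  have hY := dampedPos_rates_le hα hk hun.le hvn.le (sub_pos.2 hab).le hy hw
  generalize inner ℝ (u a) !₂[-Real.sin θ, Real.cos θ] = z at *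
  generalize inner ℝ (v a) !₂[-Real.sin θ, Real.cos θ] = ζ at *
  generalize dampedPos (slowRate α k) (fastRate α k) (inner ℝ (u a) !₂[Real.cos θ, Real.sin θ])
    (inner ℝ (v a) !₂[Real.cos θ, Real.sin θ]) (b - a) = Y at *
  have hdiff : u b - ((b - a + δ) * (p * Real.cos θ)) • !₂[-Real.sin θ, Real.cos θ]
      = Y • !₂[Real.cos θ, Real.sin θ]
        + (z + (b - a) * (ζ - p * Real.cos θ) - δ * (p * Real.cos θ)) •
          !₂[-Real.sin θ, Real.cos θ] := by
    rw [hdec]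
    module
  have hlast : |z + (b - a) * (ζ - p * Real.cos θ) - δ * (p * Real.cos θ)|
      ≤ A + (b - a) * σ + δ * p := by
    have a1 : |(b - a) * (ζ - p * Real.cos θ)| ≤ (b - a) * σ := by
      rw [abs_mul, abs_of_pos (sub_pos.2 hab)]
      exact mul_le_mul_of_nonneg_left hζ (sub_pos.2 hab).le
    have a2 : |δ * (p * Real.cos θ)| ≤ δ * p := by
      rw [abs_of_pos (by positivity)]
      gcongr
      exact mul_le_of_le_one_right hp.le (Real.cos_le_one θ)
    rw [abs_le] at a1 a2 ⊢
    constructor <;> linarith [a1.1, a1.2, a2.1, a2.2]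
  rw [hdiff]
  refine (norm_add_le _ _).trans ?_
  rw [norm_smul, norm_smul, norm_second_normal, norm_second_tangent, mul_one, mul_one,
    Real.norm_of_nonneg hY0, Real.norm_eq_abs]
  exact add_le_add hY hlast

/-- The motion along the first side stays close to its orthogonal projection on that side. -/
theorem norm_first_side_sub_le {t z : ℝ} (hα : 1 < α) (hk : 0 < k) (hp₁ : 0 < p₁) (ht : 0 ≤ t) :
    ‖(!₂[dampedPos (slowRate α k) (fastRate α k) 0 p₁ t, z] : Plane) - !₂[0, z]‖
      ≤ p₁ / (2 * √(α ^ 2 - 1) * √k) := by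
  have h1 := dampedPos_rates_le hα hk (le_refl (0 : ℝ)) hp₁.le ht le_rfl le_rfl
  have h4 : 0 ≤ dampedPos (slowRate α k) (fastRate α k) 0 p₁ t := by
    rcases ht.eq_or_lt with rfl | ht
    · rw [dampedPos_zero]
    · exact (dampedPos_pos (slowRate_pos hα hk).le (slowRate_lt_fastRate hα hk) le_rfl hp₁ ht).le
  rw [pair_sub_pair, norm_pair_zero_right, abs_of_nonneg h4]
  simpa using h1

theorem IsMotionOn.norm_sub_limitMotion_le (hc : 0 < Real.cos θ) (hs : 0 < Real.sin θ)
    (hα : 1 < α) (hk : 0 < k) (hx₂ : x₂ < 0) (hp₁ : 0 < p₁) (hp₂ : 0 < p₂)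
    (hσ : IsHarmless θ p₂ σ)
    (hE : crossingError θ α k p₂ (gap α k p₁ (-x₂ / p₂)) (gapVel α k p₁ (-x₂ / p₂)) σ < σ)
    (h : IsMotionOn θ α k 0 (Set.Ici 0) u v)
    (hu : u 0 = !₂[0, x₂]) (hv : v 0 = !₂[p₁, p₂]) {t : ℝ} (ht : 0 ≤ t) (htB : t ≤ B) :
    ‖u t - limitMotion θ (-x₂ / p₂) !₂[0, x₂] !₂[p₁, p₂] t‖ ≤ limitError θ α k x₂ p₁ p₂ σ B := by
  have hfirst := (h.mono Set.Icc_subset_Ici_self).eq_before_crossing hs hα hk hx₂ hp₁ hp₂ hu hv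
  have ht₀p : 0 < -x₂ / p₂ := div_pos (neg_pos.2 hx₂) hp₂
  have hεp := gap_pos hα hk hp₁ ht₀p
  unfold limitError
  have hu₀ : u (-x₂ / p₂) = !₂[gap α k p₁ (-x₂ / p₂), 0] := by
    rw [(hfirst _ ⟨ht₀p.le, le_rfl⟩).1, div_mul_cancel₀ _ hp₂.ne', gap]; simp
  have hv₀ : v (-x₂ / p₂) = !₂[gapVel α k p₁ (-x₂ / p₂), p₂] :=
    (hfirst _ ⟨ht₀p.le, le_rfl⟩).2
  set t₀ := -x₂ / p₂ with ht₀
  set ε := gap α k p₁ t₀ with hε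
  set ℓ := crossingTime θ p₂ with hℓ
  set β := √(α ^ 2 - 1) with hβdef
  have hβ : 0 < β := sqrt_sq_sub_one_pos hα
  have hβα : 0 < α - β := sub_pos.2 (sqrt_sq_sub_one_lt hα)
  have hsk := Real.sqrt_pos.2 hk
  have hℓp : 0 < ℓ := crossingTime_pos hc hs hp₂
  have hσp := hσ.pos
  have hB : 0 ≤ B := ht.trans htB
  have hA : 0 < ε * (1 + ℓ * (p₂ + σ)) := by positivity
  have hrate : 0 < (α - β) / (2 * β) := by positivity
  have hsplit : (p₁ + p₂ + σ) / (2 * β * √k)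
      = p₁ / (2 * β * √k) + (p₂ + σ) / (2 * β * √k) := by rw [← add_div, add_assoc]
  have q1 : 0 < p₁ / (2 * β * √k) := by positivity
  have q2 : 0 < (p₂ + σ) / (2 * β * √k) := by positivity
  have q3 : 0 < ℓ * ε * p₂ := by positivity
  have q4 : 0 ≤ B * σ := by positivity
  have q5 : 0 < (α - β) / (2 * β) * (ε * (1 + ℓ * (p₂ + σ))) := by positivity
  rcases le_or_gt t t₀ with htt₀ | htt₀
  · rw [limitMotion_of_le htt₀, (hfirst t ⟨ht, htt₀⟩).1]
    refine (norm_first_side_sub_le hα hk hp₁ ht).trans ?_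
    rw [hsplit]
    linarith
  have hm := (h.restart ht₀p.le).mono
    (Set.Icc_subset_Ici_self : Set.Icc t₀ (t₀ + ℓ * ε) ⊆ Set.Ici t₀)
  have hubound := hm.norm_le_of_crossing (by linarith) hk.le hc hs hp₂ hεp hσp hE hu₀ hv₀
  rcases le_or_gt t (t₀ + ℓ * ε) with htt₁ | htt₁
  -- During the crossing both motions are within `O(ε)` of the apex, so the triangle inequality
  -- suffices.
  · have h1 := hubound t ⟨htt₀.le, htt₁⟩
    have h2 := norm_limitMotion_le (θ := θ) (x₂ := x₂) (p₁ := p₁) hp₂.le htt₀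
    have h3 : (t - t₀) * p₂ ≤ ℓ * ε * p₂ := by gcongr; linarith
    have h4 := norm_sub_le (u t) (limitMotion θ t₀ !₂[0, x₂] !₂[p₁, p₂] t)
    rw [hsplit]
    linarith
  have hend := hm.crossing (by linarith) hk.le hc hs hp₂ hεp hσp hE hu₀ hv₀ (t₀ + ℓ * ε)
    ⟨by linarith [mul_pos hℓp hεp], le_rfl⟩
  have hu₁ := hubound (t₀ + ℓ * ε) ⟨by linarith [mul_pos hℓp hεp], le_rfl⟩
  rw [add_sub_cancel_left] at hend
  obtain ⟨i1, i2, i3, i4⟩ := inner_pos_after_crossing hc hs hp₂ hεp hσ hend.1.le hend.2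
  have hlast := ((h.restart (b := t₀ + ℓ * ε) (by positivity)).mono
    Set.Icc_subset_Ici_self).norm_sub_le_after_crossing hc hs hα hk hp₂ (mul_pos hℓp hεp) htt₁ hu₁
      hend.1.le i1 i2 i3 i4
  -- The limit motion left the apex at `t₀`, earlier than the end of the crossing by its duration `ℓ
  -- * ε`, which plays the role of `δ`.
  rw [show t - (t₀ + ℓ * ε) + ℓ * ε = t - t₀ by ring,
    ← limitMotion_of_lt htt₀ (x₂ := x₂) (p₁ := p₁)] at hlast
  have hB' : (t - (t₀ + ℓ * ε)) * σ ≤ B * σ := by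
    gcongr
    linarith [mul_pos hℓp hεp]
  refine hlast.trans ?_
  rw [hsplit]
  linarith

theorem IsPenaltySolution.exists_isMotionOn {u₀ v₀ : Plane}
    (h : IsPenaltySolution θ α k u₀ v₀ u) :
    u 0 = u₀ ∧ ∃ v, v 0 = v₀ ∧ IsMotionOn θ α k 0 (Set.Ici 0) u v := by
  obtain ⟨hu, v, hc, hd, hi⟩ := h
  have h0 : v 0 = v₀ := by simpa using (hi 0 le_rfl).2
  exact ⟨hu, v, h0, hd, hc, fun t ht => (hi t ht).1, fun t ht => by rw [h0]; exact (hi t ht).2⟩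

/-- The tangential velocity is conserved exactly on the first side up to and including `t₀`; since
`t₀ > 0`, the one-sided velocity there is the derivative. -/
theorem IsPenaltySolution.proj₁_deriv_eq (hs : 0 < Real.sin θ) (hα : 1 < α) (hk : 0 < k)
    (hx₂ : x₂ < 0) (hp₁ : 0 < p₁) (hp₂ : 0 < p₂)
    (h : IsPenaltySolution θ α k !₂[0, x₂] !₂[p₁, p₂] u) :
    proj₁ (deriv u (-x₂ / p₂)) = proj₁ !₂[p₁, p₂] := by
  obtain ⟨hu, v, hv, hm⟩ := h.exists_isMotionOn
  have ht₀p : 0 < -x₂ / p₂ := div_pos (neg_pos.2 hx₂) hp₂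
  have hd : HasDerivAt u (v (-x₂ / p₂)) (-x₂ / p₂) :=
    (hm.hasDeriv _ ht₀p.le).hasDerivAt (Ici_mem_nhds ht₀p)
  rw [hd.deriv, ((hm.mono Set.Icc_subset_Ici_self).eq_before_crossing hs hα hk hx₂ hp₁ hp₂ hu hv _
    ⟨ht₀p.le, le_rfl⟩).2, proj₁_apply, proj₁_apply]
  simp

end Limit

end CornerImpact

/-! ### The theorem -/

open CornerImpact in
theorem mainTheorem2 (θ α x₂ p₁ p₂ : ℝ) (hθ₀ : 0 < θ) (hθ : θ < Real.pi / 2) (hα : 1 < α)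
    (hx₂ : x₂ < 0) (hp₁ : 0 < p₁) (hp₂ : 0 < p₂) :
    (∀ᶠ k : ℝ in atTop, ∃ w : ℝ → Plane, IsPenaltySolution θ α k !₂[0, x₂] !₂[p₁, p₂] w) ∧
    ∀ u : ℝ → ℝ → Plane,
      (∀ᶠ k : ℝ in atTop, IsPenaltySolution θ α k !₂[0, x₂] !₂[p₁, p₂] (u k)) →
      (∀ᶠ k : ℝ in atTop, proj₁ (deriv (u k) (-x₂ / p₂)) = proj₁ !₂[p₁, p₂]) ∧
      ∀ S : Set ℝ, S ⊆ Set.Ici 0 → IsCompact S →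
        TendstoUniformlyOn u
          (limitMotion θ (-x₂ / p₂) !₂[0, x₂] !₂[p₁, p₂]) atTop S := by
  have hc : 0 < Real.cos θ := Real.cos_pos_of_mem_Ioo ⟨by linarith, hθ⟩
  have hs : 0 < Real.sin θ := Real.sin_pos_of_pos_of_lt_pi hθ₀ (by linarith [Real.pi_pos])
  have ht₀p : 0 < -x₂ / p₂ := div_pos (neg_pos.2 hx₂) hp₂
  have hharm := eventually_isHarmless hc hs hp₂
  refine ⟨?_, fun u hu => ⟨?_, fun S hS hSc => ?_⟩⟩
  · obtain ⟨σ, hσ⟩ := hharm.exists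
    filter_upwards [eventually_gt_atTop 0,
      (tendsto_crossingError θ p₂ σ hα hp₁ ht₀p).eventually_lt_const (half_pos hσ.pos)]
      with k hk hE using exists_isPenaltySolution hc hs hα hk hx₂ hp₁ hp₂ hσ hE
  · filter_upwards [eventually_gt_atTop 0, hu] with k hk hu
      using hu.proj₁_deriv_eq hs hα hk hx₂ hp₁ hp₂
  · rw [Metric.tendstoUniformlyOn_iff]
    intro e he
    obtain ⟨B, hB⟩ := hSc.bddAbove
    have hBσ : Tendsto (fun σ : ℝ => B * σ) (𝓝[>] 0) (𝓝 0) := by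
      have : Tendsto (fun σ : ℝ => B * σ) (𝓝 0) (𝓝 (B * 0)) :=
        (continuous_const.mul continuous_id).tendsto 0
      rw [mul_zero] at this
      exact this.mono_left nhdsWithin_le_nhds
    -- The tolerance `σ` is fixed before `k`: it must be harmless for the crossing and make the
    -- residual drift `B * σ` smaller than `e`.
    obtain ⟨σ, hσ, hσe⟩ := (hharm.and (hBσ.eventually_lt_const he)).exists
    filter_upwards [eventually_gt_atTop 0, hu,
      (tendsto_crossingError θ p₂ σ hα hp₁ ht₀p).eventually_lt_const hσ.pos,
      (tendsto_limitError (θ := θ) (σ := σ) (B := B) hα hx₂ hp₁ hp₂).eventually_lt_const hσe]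
      with k hk hu hE hlim t ht
    obtain ⟨hu₀, v, hv₀, hm⟩ := hu.exists_isMotionOn
    rw [dist_comm, dist_eq_norm]
    exact (hm.norm_sub_limitMotion_le hc hs hα hk hx₂ hp₁ hp₂ hσ hE hu₀ hv₀ (hS ht)
      (hB ht)).trans_lt hlim
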